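/- Let $\mathfrak g$ be a real Lie algebra of anti-Hermitian $n\times n$ complex matrices (the Lie algebra of the gauge group; it need not be abelian), with $\operatorname{tr}$ the matrix trace. Let $\Omega\subseteq\mathbb R^{1,3}$ be an open subset of Minkowski space, with metric $\operatorname{diag}(-1,1,1,1)$ and $\epsilon_{0123}=1$. Let $A_\mu$ be a smooth $\mathfrak g$-valued gauge potential on $\Omega$, with $F_{\mu\nu}=\nabla_\mu A_\nu-\nabla_\nu A_\mu+[A_\mu,A_\nu]$ and $D_\alpha F_{\mu\nu}=\nabla_\alpha F_{\mu\nu}+[A_\alpha,F_{\mu\nu}]$. Put $$W=\int\tfrac14\operatorname{tr}(F_{\mu\nu}F^{\mu\nu})\,d^4x,\qquad \tilde H(f)=\int\tfrac14\epsilon^{\mu\nu\alpha\beta}f\operatorname{tr}(F_{\mu\nu}F_{\alpha\beta})\,d^4x .$$ Variations $\delta A$ are smooth, $\mathfrak g$-valued and supported in a compact set $K\subseteq\Omega$ (so that $\delta A=0$ at $\partial\Omega$), and the integrals are varied over $K$. (a) Suppose that $A$ is an extremal of $W$ subject to the pointwise constraint $\epsilon^{\mu\nu\alpha\beta}\operatorname{tr}(F_{\mu\nu}F_{\alpha\beta})=0$;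 that is, $A$ satisfies the constraint, and $\delta W=0$ for every variation $\delta A$ for which the first variation of the constraint vanishes on $\Omega$. Suppose also that $A$ is a regular point of the constraint: at each $x\in\Omega$, $\epsilon^{\mu\nu\alpha\beta}\xi_\nu F_{\alpha\beta}(x)=0$ for all $\mu$ only if $\xi=0$ (equivalently, the linearized constraint has a surjective principal symbol). Then there is a smooth function $f$ on $\Omega$ (a spacetime-dependent Lagrange multiplier) such that $A$ is an extremal, without constraint, of $W-\tfrac12\tilde H(f)$, and $A$ satisfies the covariant non-abelian Beltrami equation $$D^\nu F_{\mu\nu}=\tfrac12\epsilon_{\mu\nu\alpha\beta}\lambda^\nu F^{\alpha\beta},\qquad \lambda_\mu=\nabla_\mu f,\qquad\text{on }\Omega .$$ (b) Whether or not $A$ is regular or satisfies the constraint, if $f$ is a smooth function on $\Omega$ such that $A$ is an extremal, without constraint, of $W-\tfrac12\tilde H(f)$, then $A$ satisfies the same Beltrami equation with $\lambda_\mu=\nabla_\mu f$. -/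

import Mathlib

open scoped Matrix ContDiff

attribute [local instance] Matrix.normedAddCommGroup Matrix.normedSpace
attribute [local instance 100] LieRing.ofAssociativeRing

noncomputable section

namespace YangMills

/-- Points of `ℝ^{1,3}` in Cartesian coordinates `x⁰, x¹, x², x³`. -/
abbrev Spacetime : Type := Fin 4 → ℝ

/-- Diagonal entries of the Minkowski metric `diag(-1, 1, 1, 1)`, which is its own inverse.  An index
`μ` is raised or lowered by multiplication with `eta μ`. -/
def eta (μ : Fin 4) : ℝ := if μ = 0 then -1 else 1

/-- The totally antisymmetric symbol `ε_{μναβ}` with `ε_{0123} = 1`: the determinant of the matrix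
whose rows are the basis vectors number `μ, ν, α, β`. -/
def epsLower (μ ν α β : Fin 4) : ℝ :=
  Matrix.det (Matrix.of fun i j : Fin 4 => if ![μ, ν, α, β] i = j then (1 : ℝ) else 0)

/-- `ε^{μναβ}`, all four indices raised with the metric. -/
def epsUpper (μ ν α β : Fin 4) : ℝ :=
  eta μ * eta ν * eta α * eta β * epsLower μ ν α β

/-- The coordinate derivative `∇_μ φ` at `x`. -/
def partialD {V : Type*} [NormedAddCommGroup V] [NormedSpace ℝ V]
    (μ : Fin 4) (φ : Spacetime → V) (x : Spacetime) : V :=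
  fderiv ℝ φ x (Pi.single μ 1)

/-- Matrix-valued covector fields `A_μ(x)`. -/
abbrev GaugeField (n : ℕ) : Type := Spacetime → Fin 4 → Matrix (Fin n) (Fin n) ℂ

/-- The trace form `tr (X Y)`.  It is a real number for anti-Hermitian `X` and `Y`, and is read as
one by taking the real part. -/
def trForm {n : ℕ} (X Y : Matrix (Fin n) (Fin n) ℂ) : ℝ := (Matrix.trace (X * Y)).re

variable {n : ℕ}

/-- The field strength `F_{μν} = ∇_μ A_ν - ∇_ν A_μ + [A_μ, A_ν]` at `x`. -/
def fieldStrength (A : GaugeField n) (x : Spacetime) (μ ν : Fin 4) : Matrix (Fin n) (Fin n) ℂ :=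
  partialD μ (fun y => A y ν) x - partialD ν (fun y => A y μ) x + ⁅A x μ, A x ν⁆

/-- `F^{μν}` at `x`. -/
def fieldStrengthUpper (A : GaugeField n) (x : Spacetime) (μ ν : Fin 4) : Matrix (Fin n) (Fin n) ℂ :=
  (eta μ * eta ν) • fieldStrength A x μ ν

/-- The gauge covariant derivative `D_α F_{μν} = ∇_α F_{μν} + [A_α, F_{μν}]` at `x`. -/
def covD (A : GaugeField n) (α μ ν : Fin 4) (x : Spacetime) : Matrix (Fin n) (Fin n) ℂ :=
  partialD α (fun y => fieldStrength A y μ ν) x + ⁅A x α, fieldStrength A x μ ν⁆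

/-- The density `¼ tr (F_{μν} F^{μν})`. -/
def ymDensity (A : GaugeField n) (x : Spacetime) : ℝ :=
  1 / 4 * ∑ μ, ∑ ν, trForm (fieldStrength A x μ ν) (fieldStrengthUpper A x μ ν)

/-- The density `ε^{μναβ} tr (F_{μν} F_{αβ})`. -/
def epsFF (A : GaugeField n) (x : Spacetime) : ℝ :=
  ∑ μ, ∑ ν, ∑ α, ∑ β,
    epsUpper μ ν α β * trForm (fieldStrength A x μ ν) (fieldStrength A x α β)

/-- The Yang–Mills functional `W` over a region `K`. -/
def action (K : Set Spacetime) (A : GaugeField n) : ℝ := ∫ x in K, ymDensity A x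

/-- The functional `H̃(f) = ∫ ¼ ε^{μναβ} f tr (F_{μν} F_{αβ})` over a region `K`. -/
def helicity (K : Set Spacetime) (f : Spacetime → ℝ) (A : GaugeField n) : ℝ :=
  ∫ x in K, 1 / 4 * f x * epsFF A x

/-- Smooth gauge potentials on `Ω` with values in the Lie algebra `𝔤`. -/
structure IsPotential (𝔤 : LieSubalgebra ℝ (Matrix (Fin n) (Fin n) ℂ)) (Ω : Set Spacetime)
    (A : GaugeField n) : Prop where
  smooth : ContDiffOn ℝ ∞ A Ω
  mem : ∀ x ∈ Ω, ∀ μ, A x μ ∈ 𝔤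

/-- Variations `δA` of a potential on `Ω`: smooth, `𝔤`-valued, supported in the compact set `K ⊆ Ω`
(so that they vanish at the boundary of `Ω`).  A functional that may diverge over all of `Ω` is
varied over `K`, outside which the variation changes nothing. -/
structure IsVariation (𝔤 : LieSubalgebra ℝ (Matrix (Fin n) (Fin n) ℂ)) (Ω K : Set Spacetime)
    (a : GaugeField n) : Prop where
  smooth : ContDiff ℝ ∞ a
  mem : ∀ x μ, a x μ ∈ 𝔤
  compact : IsCompact K
  subset : K ⊆ Ω
  support : tsupport a ⊆ K

/-- `A` is an extremal of `W` on `Ω` subject to the pointwise constraint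
`ε^{μναβ} tr (F_{μν} F_{αβ}) = 0`: it satisfies the constraint, and the first variation of `W`
vanishes for every variation under which the first variation of the constraint is zero. -/
structure IsConstrainedExtremal (𝔤 : LieSubalgebra ℝ (Matrix (Fin n) (Fin n) ℂ))
    (Ω : Set Spacetime) (A : GaugeField n) : Prop where
  constraint : ∀ x ∈ Ω, epsFF A x = 0
  stationary : ∀ (K : Set Spacetime) (a : GaugeField n), IsVariation 𝔤 Ω K a →
    (∀ x ∈ Ω, HasDerivAt (fun s : ℝ => epsFF (A + s • a) x) 0 0) →
    HasDerivAt (fun s : ℝ => action K (A + s • a)) 0 0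

/-- `A` is an extremal of the functional `W - ½ H̃(f)` on `Ω`, without constraint. -/
def IsMultiplierExtremal (𝔤 : LieSubalgebra ℝ (Matrix (Fin n) (Fin n) ℂ)) (Ω : Set Spacetime)
    (f : Spacetime → ℝ) (A : GaugeField n) : Prop :=
  ∀ (K : Set Spacetime) (a : GaugeField n), IsVariation 𝔤 Ω K a →
    HasDerivAt (fun s : ℝ => action K (A + s • a) - 1 / 2 * helicity K f (A + s • a)) 0 0

/-- `A` is a regular point of the constraint on `Ω`: at no point is there a covector `ξ ≠ 0` with
`ε^{μναβ} ξ_ν F_{αβ} = 0` for all `μ`.  As the first variation of `ε^{μναβ} tr (F_{μν} F_{αβ})` is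
`4 ε^{μναβ} ∇_μ tr (δA_ν F_{αβ})`, this says that the linearized constraint, a first-order
differential operator in `δA`, has a surjective principal symbol. -/
def IsRegular (Ω : Set Spacetime) (A : GaugeField n) : Prop :=
  ∀ x ∈ Ω, ∀ ξ : Fin 4 → ℝ, ξ ≠ 0 →
    ∃ μ, ∑ ν, ∑ α, ∑ β, (epsUpper μ ν α β * ξ ν) • fieldStrength A x α β ≠ 0

/-- The Beltrami equation `D^ν F_{μν} = ½ ε_{μναβ} λ^ν F^{αβ}` on `Ω` with `λ_ν = ∇_ν f`. -/
def IsBeltrami (Ω : Set Spacetime) (f : Spacetime → ℝ) (A : GaugeField n) : Prop :=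
  ∀ x ∈ Ω, ∀ μ,
    ∑ ν, eta ν • covD A ν μ ν x =
      (1 / 2 : ℝ) • ∑ ν, ∑ α, ∑ β,
        (epsLower μ ν α β * (eta ν * partialD ν f x)) • fieldStrengthUpper A x α β

end YangMills

end

/-! ### The Levi-Civita symbol and the trace form. -/

noncomputable section

namespace YangMills

/-! Two first variations carry the proof. By the Bianchi identity (`covD_cyclic`) and the invariance
of the trace, the constraint density varies by `4 ∂_μ J^μ`, where `J^μ = ε^{μναβ} tr (δA_ν F_{αβ})`
is `topCurrent` (`epsFF_variation`). The functional `W` varies by the integral of `tr (E^ν δA_ν)`,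
with `E` the Yang–Mills current, index raised (`hasDerivAt_action`). Integrating by parts against
`f` gives `δH̃(f) = -∫ ∇_μ f J^μ`, so `W - ½ H̃(f)` has a pointwise Euler–Lagrange expression, which
is the Beltrami equation up to raising an index. The trace form is negative definite on
anti-Hermitian matrices, so testing with a bump times this `𝔤`-valued expression shows that it
vanishes. This proves (b) and its converse (`isMultiplierExtremal_iff_isBeltrami`).

For (a), `J` is algebraic in `δA`: at each point it is a linear map to `ℝ⁴`, with transpose `ξ ↦
ε^{μναβ} ξ_μ F_{αβ}` (`dualCurrent`). Regularity says that the transpose is injective, so the Gram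
matrix `symbolGram` is invertible and `J` has a smooth right inverse. The part of `E` orthogonal to
the range of the transpose is annihilated by `J`, so its multiples by bumps are admissible
variations, and stationarity makes it vanish: `E` is the transpose applied to a smooth covector
field `m` (`multiplier`). Next, every compactly supported divergence-free field `v` is `J` of an
admissible variation, whence `∫ m_μ v^μ = 0`.

It remains that a one-form annihilating all such `v` is exact, on any open set
(`exists_primitive_of_integral_divergenceFree_eq_zero`). A closed polygon, smeared by a bump, is a
divergence-free field whose pairing with the form approximates the period, so all periods vanish and
line integrals define a primitive. Then `f` is `-2` times the primitive of `m`. -/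

lemma epsLower_swap₀₁ (μ ν α β : Fin 4) : epsLower ν μ α β = -epsLower μ ν α β := by
  have := Matrix.det_permute (Equiv.swap (0 : Fin 4) 1)
    (Matrix.of fun i j : Fin 4 => if ![μ, ν, α, β] i = j then (1 : ℝ) else 0)
  rw [Equiv.Perm.sign_swap (by decide)] at this
  rw [Units.val_neg, Units.val_one, Int.cast_neg, Int.cast_one, neg_one_mul] at this
  rw [epsLower, epsLower, ← this]
  congr 1
  ext i j; fin_cases i <;> simp [Equiv.swap_apply_def] <;> congr

lemma epsLower_swap₁₂ (μ ν α β : Fin 4) : epsLower μ α ν β = -epsLower μ ν α β := by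
  have := Matrix.det_permute (Equiv.swap (1 : Fin 4) 2)
    (Matrix.of fun i j : Fin 4 => if ![μ, ν, α, β] i = j then (1 : ℝ) else 0)
  rw [Equiv.Perm.sign_swap (by decide)] at this
  rw [Units.val_neg, Units.val_one, Int.cast_neg, Int.cast_one, neg_one_mul] at this
  rw [epsLower, epsLower, ← this]
  congr 1
  ext i j; fin_cases i <;> simp [Equiv.swap_apply_def] <;> congr

lemma epsLower_swap₂₃ (μ ν α β : Fin 4) : epsLower μ ν β α = -epsLower μ ν α β := by
  have := Matrix.det_permute (Equiv.swap (2 : Fin 4) 3)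
    (Matrix.of fun i j : Fin 4 => if ![μ, ν, α, β] i = j then (1 : ℝ) else 0)
  rw [Equiv.Perm.sign_swap (by decide)] at this
  rw [Units.val_neg, Units.val_one, Int.cast_neg, Int.cast_one, neg_one_mul] at this
  rw [epsLower, epsLower, ← this]
  congr 1
  ext i j; fin_cases i <;> simp [Equiv.swap_apply_def] <;> congr

lemma epsUpper_swap₀₁ (μ ν α β : Fin 4) : epsUpper ν μ α β = -epsUpper μ ν α β := by
  rw [epsUpper, epsUpper, epsLower_swap₀₁ μ ν α β]; ring

lemma epsUpper_swap₁₂ (μ ν α β : Fin 4) : epsUpper μ α ν β = -epsUpper μ ν α β := by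
  rw [epsUpper, epsUpper, epsLower_swap₁₂ μ ν α β]; ring

lemma epsUpper_swap₂₃ (μ ν α β : Fin 4) : epsUpper μ ν β α = -epsUpper μ ν α β := by
  rw [epsUpper, epsUpper, epsLower_swap₂₃ μ ν α β]; ring

/-- The permutation is even: four adjacent transpositions. -/
lemma epsUpper_pair (μ ν α β : Fin 4) : epsUpper α β μ ν = epsUpper μ ν α β := by
  rw [epsUpper_swap₁₂ α μ β ν, epsUpper_swap₀₁ μ α β ν, epsUpper_swap₂₃ μ α ν β,
    epsUpper_swap₁₂ μ ν α β]
  ring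

lemma epsUpper_cycle (μ ν α β : Fin 4) : epsUpper α ν β μ = epsUpper μ ν α β := by
  rw [epsUpper_swap₂₃ α ν μ β, epsUpper_swap₁₂ α μ ν β, epsUpper_swap₀₁ μ α ν β,
    epsUpper_swap₁₂ μ ν α β]
  ring

lemma eta_mul_self (μ : Fin 4) : eta μ * eta μ = 1 := by
  unfold eta; split_ifs <;> norm_num

lemma eta_ne_zero (μ : Fin 4) : eta μ ≠ 0 := by
  unfold eta; split_ifs <;> norm_num

/-- A sum against `ε^{μναβ}` over `μ, α, β` vanishes if the cyclic sums do. -/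
lemma sum_epsUpper_smul_eq_zero {V : Type*} [AddCommGroup V] [Module ℝ V]
    (T : Fin 4 → Fin 4 → Fin 4 → V)
    (hT : ∀ μ α β, T μ α β + T α β μ + T β μ α = 0) (ν : Fin 4) :
    ∑ μ, ∑ α, ∑ β, epsUpper μ ν α β • T μ α β = 0 := by
  -- Renaming the summation indices along a three-cycle, which fixes `ε`, shows that the three
  -- cyclic sums agree; each is therefore a third of their total, which is zero.
  have h1 : ∑ μ, ∑ α, ∑ β, epsUpper μ ν α β • T μ α β
      = ∑ μ, ∑ α, ∑ β, epsUpper μ ν α β • T α β μ := by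
    calc _ = ∑ α, ∑ β, ∑ μ, epsUpper α ν β μ • T α β μ := rfl
      _ = ∑ α, ∑ μ, ∑ β, epsUpper α ν β μ • T α β μ :=
        Finset.sum_congr rfl fun _ _ => Finset.sum_comm
      _ = ∑ μ, ∑ α, ∑ β, epsUpper α ν β μ • T α β μ := Finset.sum_comm
      _ = _ := by simp only [epsUpper_cycle]
  have h2 : ∑ μ, ∑ α, ∑ β, epsUpper μ ν α β • T α β μ
      = ∑ μ, ∑ α, ∑ β, epsUpper μ ν α β • T β μ α := by
    calc _ = ∑ α, ∑ β, ∑ μ, epsUpper α ν β μ • T β μ α := rfl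
      _ = ∑ α, ∑ μ, ∑ β, epsUpper α ν β μ • T β μ α :=
        Finset.sum_congr rfl fun _ _ => Finset.sum_comm
      _ = ∑ μ, ∑ α, ∑ β, epsUpper α ν β μ • T β μ α := Finset.sum_comm
      _ = _ := by simp only [epsUpper_cycle]
  have h3 : ∑ μ, ∑ α, ∑ β, epsUpper μ ν α β • T μ α β
      + ∑ μ, ∑ α, ∑ β, epsUpper μ ν α β • T α β μ
      + ∑ μ, ∑ α, ∑ β, epsUpper μ ν α β • T β μ α = 0 := by
    simp only [← Finset.sum_add_distrib, ← smul_add, hT, smul_zero, Finset.sum_const_zero]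
  rw [← h2, ← h1] at h3
  have h4 : (3 : ℝ) • ∑ μ, ∑ α, ∑ β, epsUpper μ ν α β • T μ α β = 0 := by
    rw [← h3]; module
  exact (smul_eq_zero.1 h4).resolve_left (by norm_num)

variable {n : ℕ}

/-- The trace form as a continuous bilinear map. -/
def trFormL (n : ℕ) : Matrix (Fin n) (Fin n) ℂ →L[ℝ] Matrix (Fin n) (Fin n) ℂ →L[ℝ] ℝ :=
  LinearMap.toContinuousBilinearMap (LinearMap.mk₂ ℝ trForm
    (fun X Y Z => by simp [trForm, add_mul])
    (fun c X Y => by simp [trForm])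
    (fun X Y Z => by simp [trForm, mul_add])
    (fun c X Y => by simp [trForm]))

/-- The commutator as a continuous bilinear map. -/
def lieL (n : ℕ) : Matrix (Fin n) (Fin n) ℂ →L[ℝ] Matrix (Fin n) (Fin n) ℂ →L[ℝ]
    Matrix (Fin n) (Fin n) ℂ :=
  LinearMap.toContinuousBilinearMap (LinearMap.mk₂ ℝ (fun X Y => ⁅X, Y⁆)
    (fun X Y Z => by simp)
    (fun c X Y => by simp [Ring.lie_def, smul_sub])
    (fun X Y Z => by simp)
    (fun c X Y => by simp [Ring.lie_def, smul_sub]))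

lemma trForm_comm (X Y : Matrix (Fin n) (Fin n) ℂ) : trForm X Y = trForm Y X := by
  rw [trForm, Matrix.trace_mul_comm, trForm]

lemma trForm_add_left (X Y Z : Matrix (Fin n) (Fin n) ℂ) :
    trForm (X + Y) Z = trForm X Z + trForm Y Z := by simp [trForm, add_mul]

lemma trForm_add_right (X Y Z : Matrix (Fin n) (Fin n) ℂ) :
    trForm X (Y + Z) = trForm X Y + trForm X Z := by simp [trForm, mul_add]

lemma trForm_sub_left (X Y Z : Matrix (Fin n) (Fin n) ℂ) :
    trForm (X - Y) Z = trForm X Z - trForm Y Z := by simp [trForm, sub_mul]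

lemma trForm_neg_left (X Y : Matrix (Fin n) (Fin n) ℂ) :
    trForm (-X) Y = -trForm X Y := by simp [trForm]

lemma trForm_neg_right (X Y : Matrix (Fin n) (Fin n) ℂ) :
    trForm X (-Y) = -trForm X Y := by simp [trForm]

lemma trForm_smul_left (c : ℝ) (X Y : Matrix (Fin n) (Fin n) ℂ) :
    trForm (c • X) Y = c * trForm X Y := by simp [trForm]

lemma trForm_smul_right (c : ℝ) (X Y : Matrix (Fin n) (Fin n) ℂ) :
    trForm X (c • Y) = c * trForm X Y := by simp [trForm]

lemma trForm_zero_left (X : Matrix (Fin n) (Fin n) ℂ) : trForm 0 X = 0 := by simp [trForm]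

lemma trForm_zero_right (X : Matrix (Fin n) (Fin n) ℂ) : trForm X 0 = 0 := by simp [trForm]

lemma trForm_sum_left {ι : Type*} (s : Finset ι) (X : ι → Matrix (Fin n) (Fin n) ℂ)
    (Y : Matrix (Fin n) (Fin n) ℂ) : trForm (∑ i ∈ s, X i) Y = ∑ i ∈ s, trForm (X i) Y := by
  simp [trForm, Finset.sum_mul, Matrix.trace_sum]

lemma trForm_sum_right {ι : Type*} (s : Finset ι) (X : ι → Matrix (Fin n) (Fin n) ℂ)
    (Y : Matrix (Fin n) (Fin n) ℂ) : trForm Y (∑ i ∈ s, X i) = ∑ i ∈ s, trForm Y (X i) := by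
  simp [trForm, Finset.mul_sum, Matrix.trace_sum]

/-- The trace form is invariant. -/
lemma trForm_lie (X Y Z : Matrix (Fin n) (Fin n) ℂ) : trForm X ⁅Y, Z⁆ = trForm ⁅X, Y⁆ Z := by
  have h : Matrix.trace (X * (Z * Y)) = Matrix.trace (Y * X * Z) := by
    rw [← mul_assoc, Matrix.trace_mul_comm, mul_assoc]
  simp only [trForm, Ring.lie_def, mul_sub, sub_mul, Matrix.trace_sub, h, mul_assoc]

-- For anti-Hermitian `X`, `tr (X X) = -tr (Xᴴ X)`, minus the sum of the squared moduli of the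
-- entries. Hence the trace form is negative definite on `𝔤`; every positivity argument below comes
-- from here.
open scoped ComplexOrder in
lemma trForm_self_nonpos {X : Matrix (Fin n) (Fin n) ℂ} (hX : Xᴴ = -X) : trForm X X ≤ 0 := by
  have h : trForm X X = -(Matrix.trace (Xᴴ * X)).re := by simp [trForm, hX]
  have := (Complex.le_def.1 (Matrix.posSemidef_conjTranspose_mul_self X).trace_nonneg).1
  rw [h]; simpa using this

open scoped ComplexOrder in
lemma eq_zero_of_trForm_self {X : Matrix (Fin n) (Fin n) ℂ} (hX : Xᴴ = -X)
    (h0 : trForm X X = 0) : X = 0 := by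
  have h : trForm X X = -(Matrix.trace (Xᴴ * X)).re := by simp [trForm, hX]
  have h2 := Complex.le_def.1 (Matrix.posSemidef_conjTranspose_mul_self X).trace_nonneg
  rw [← Matrix.trace_conjTranspose_mul_self_eq_zero_iff]
  apply Complex.ext
  · simp; linarith
  · exact h2.2.symm

end YangMills

end

/-! ### Integrals with a parameter, and vector fields concentrated along a segment. -/

noncomputable section

open MeasureTheory Set Metric in
/-- Differentiation under the integral sign over a compact interval. -/
lemma hasFDerivAt_intervalIntegral_of_contDiff {E F : Type*} [NormedAddCommGroup E]
    [NormedSpace ℝ E] [FiniteDimensional ℝ E] [NormedAddCommGroup F] [NormedSpace ℝ F]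
    [CompleteSpace F] {g : E → ℝ → F} (hg : ContDiff ℝ ∞ (Function.uncurry g)) (a b : ℝ) (x : E) :
    HasFDerivAt (fun x => ∫ t in a..b, g x t) (∫ t in a..b, fderiv ℝ (fun y => g y t) x) x := by
  have hg' : ContDiff ℝ ∞ (fun p : E × ℝ => fderiv ℝ (fun y => g y p.2) p.1) := by
    refine ContDiff.fderiv (m := ∞) (n := ∞) (f := fun (p : E × ℝ) y => g y p.2) ?_
      contDiff_fst (by simp)
    exact hg.comp (contDiff_snd.prodMk (contDiff_snd.comp contDiff_fst))
  have hcont : ∀ y, Continuous (g y) := fun y =>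
    hg.continuous.comp (continuous_const.prodMk continuous_id)
  obtain ⟨C, hC⟩ := ((isCompact_closedBall x 1).prod (isCompact_uIcc (a := a) (b := b))
    ).exists_bound_of_continuousOn hg'.continuous.continuousOn
  refine intervalIntegral.hasFDerivAt_integral_of_dominated_of_fderiv_le
    (F' := fun y t => fderiv ℝ (fun y => g y t) y) (bound := fun _ => C)
    (closedBall_mem_nhds x one_pos) ?_ ?_ ?_ ?_ ?_ ?_
  · exact Filter.Eventually.of_forall fun y => (hcont y).aestronglyMeasurable
  · exact (hcont x).intervalIntegrable _ _
  · exact (hg'.continuous.comp (continuous_const.prodMk continuous_id)).aestronglyMeasurable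
  · exact Filter.Eventually.of_forall fun t ht y hy => hC (y, t) ⟨hy, uIoc_subset_uIcc ht⟩
  · exact intervalIntegrable_const
  · refine Filter.Eventually.of_forall fun t _ y _ => ?_
    have : ContDiff ℝ ∞ (fun y => g y t) := hg.comp (contDiff_id.prodMk contDiff_const)
    exact (this.differentiable (by simp) y).hasFDerivAt

-- The derivative of the integral is again such an integral, with values in `E →L[ℝ] F`, so
-- induction on the order applies. The common universe lets the induction replace `F` by `E →L[ℝ]
-- F`.
universe u in
lemma contDiff_intervalIntegral {E F : Type u} [NormedAddCommGroup E]
    [NormedSpace ℝ E] [FiniteDimensional ℝ E] [NormedAddCommGroup F] [NormedSpace ℝ F]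
    [CompleteSpace F] {g : E → ℝ → F} (hg : ContDiff ℝ ∞ (Function.uncurry g)) (a b : ℝ) :
    ContDiff ℝ ∞ (fun x => ∫ t in a..b, g x t) := by
  rw [contDiff_infty]
  intro m
  induction m generalizing F with
  | zero =>
    exact contDiff_zero.2 (continuous_iff_continuousAt.2 fun x =>
      (hasFDerivAt_intervalIntegral_of_contDiff hg a b x).continuousAt)
  | succ m ih =>
    have hg' : ContDiff ℝ ∞ (fun p : E × ℝ => fderiv ℝ (fun y => g y p.2) p.1) := by
      refine ContDiff.fderiv (m := ∞) (n := ∞) (f := fun (p : E × ℝ) y => g y p.2) ?_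
        contDiff_fst (by simp)
      exact hg.comp (contDiff_snd.prodMk (contDiff_snd.comp contDiff_fst))
    exact contDiff_succ_iff_hasFDerivAt.2
      ⟨_, ih (g := fun x t => fderiv ℝ (fun y => g y t) x) hg',
        hasFDerivAt_intervalIntegral_of_contDiff hg a b⟩

/-- The divergence of a vector field. -/
def divergence {d : ℕ} (v : (Fin d → ℝ) → Fin d → ℝ) (x : Fin d → ℝ) : ℝ :=
  ∑ i, fderiv ℝ v x (Pi.single i 1) i

lemma divergence_add {d : ℕ} {v w : (Fin d → ℝ) → Fin d → ℝ} {x : Fin d → ℝ}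
    (hv : DifferentiableAt ℝ v x) (hw : DifferentiableAt ℝ w x) :
    divergence (fun y => v y + w y) x = divergence v x + divergence w x := by
  simp only [divergence, ← Finset.sum_add_distrib]
  refine Finset.sum_congr rfl fun i _ => ?_
  rw [fderiv_fun_add hv hw]; rfl

lemma divergence_smul_const {d : ℕ} {ψ : (Fin d → ℝ) → ℝ} {x : Fin d → ℝ}
    (hψ : DifferentiableAt ℝ ψ x) (w : Fin d → ℝ) :
    divergence (fun y => ψ y • w) x = fderiv ℝ ψ x w := by
  have h : fderiv ℝ (fun y => ψ y • w) x = (fderiv ℝ ψ x).smulRight w :=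
    (hψ.hasFDerivAt.smul_const w).fderiv
  simp only [divergence, h, ContinuousLinearMap.smulRight_apply, Pi.smul_apply, smul_eq_mul]
  conv_rhs => rw [pi_eq_sum_univ' w, map_sum]
  refine Finset.sum_congr rfl fun i _ => ?_
  rw [map_smul, smul_eq_mul, mul_comm]

open MeasureTheory Set Metric

variable {d : ℕ}

/-- A bump function spread along a segment is a compactly supported vector field whose divergence is
the difference of the bumps at the end points; paired with a one-form, it approximates the integral
of that form along the segment. -/
lemma exists_field_along_segment {Ω : Set (Fin d → ℝ)} (hΩ : IsOpen Ω)
    {Λ : (Fin d → ℝ) → (Fin d → ℝ) →L[ℝ] ℝ} (hΛ : ContinuousOn Λ Ω) {p q : Fin d → ℝ}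
    (hpq : segment ℝ p q ⊆ Ω) {ε : ℝ} (hε : 0 < ε) :
    ∃ δ > 0, ∀ φ : (Fin d → ℝ) → ℝ, ContDiff ℝ ∞ φ → (∀ x, 0 ≤ φ x) → ∫ x, φ x = 1 →
      Function.support φ ⊆ ball 0 δ →
      ∃ v : (Fin d → ℝ) → Fin d → ℝ, ContDiff ℝ ∞ v ∧ HasCompactSupport v ∧ tsupport v ⊆ Ω ∧
        (∀ x, divergence v x = φ (x - p) - φ (x - q)) ∧
        |(∫ x, Λ x (v x)) - ∫ t in (0 : ℝ)..1, Λ (p + t • (q - p)) (q - p)| ≤ ε := by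
  have hseg : IsCompact (segment ℝ p q) := by
    rw [segment_eq_image_lineMap]
    exact isCompact_Icc.image (AffineMap.lineMap_continuous)
  -- The radius `δ₀` keeps the smeared segment inside `Ω`; `δ₁` below keeps the variation of `Λ · w`
  -- over a bump within `ε`.
  obtain ⟨δ₀, hδ₀, hK⟩ := hseg.exists_cthickening_subset_open hΩ hpq
  set w := q - p with hw
  set K := cthickening δ₀ (segment ℝ p q) with hKdef
  have hKc : IsCompact K := hseg.cthickening
  have hmem : ∀ t ∈ Icc (0 : ℝ) 1, p + t • w ∈ segment ℝ p q := fun t ht => by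
    rw [segment_eq_image']; exact ⟨t, ht, rfl⟩
  have hΛw : ContinuousOn (fun x => Λ x w) K := (hΛ.mono hK).clm_apply continuousOn_const
  obtain ⟨δ₁, hδ₁, hu⟩ := Metric.uniformContinuousOn_iff_le.1
    (hKc.uniformContinuousOn_of_continuous hΛw) ε hε
  refine ⟨min δ₀ δ₁, lt_min hδ₀ hδ₁, fun φ hφ hφ0 hφ1 hφs => ?_⟩
  set g : (Fin d → ℝ) → ℝ → ℝ := fun x t => φ (x - (p + t • w)) with hg
  have hgs : ContDiff ℝ ∞ (Function.uncurry g) := by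
    refine hφ.comp ?_
    exact contDiff_fst.sub (contDiff_const.add (contDiff_snd.smul contDiff_const))
  have hgd : ∀ x t, g x t ≠ 0 → dist x (p + t • w) < min δ₀ δ₁ := fun x t h => by
    have := hφs (Function.mem_support.2 h)
    rwa [mem_ball_zero_iff, ← dist_eq_norm] at this
  have hgK : ∀ x, ∀ t ∈ Icc (0 : ℝ) 1, g x t ≠ 0 → x ∈ K := fun x t ht h =>
    mem_cthickening_of_dist_le _ _ _ _ (hmem t ht) ((hgd x t h).le.trans (min_le_left _ _))
  set ψ : (Fin d → ℝ) → ℝ := fun x => ∫ t in (0 : ℝ)..1, g x t with hψ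
  have hψs : ContDiff ℝ ∞ ψ := contDiff_intervalIntegral hgs 0 1
  have hψK : ∀ x, x ∉ K → ψ x = 0 := fun x hx => by
    rw [hψ]
    refine intervalIntegral.integral_zero_ae (Filter.Eventually.of_forall fun t ht => ?_)
    rw [uIoc_of_le zero_le_one] at ht
    by_contra h
    exact hx (hgK x t ⟨ht.1.le, ht.2⟩ h)
  have hψt : tsupport (fun x => ψ x • w) ⊆ K := by
    refine closure_minimal (fun x hx => ?_) hKc.isClosed
    by_contra h
    exact hx (by simp [hψK x h])
  refine ⟨fun x => ψ x • w, hψs.smul contDiff_const,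
    hKc.of_isClosed_subset (isClosed_tsupport _) hψt, hψt.trans hK, fun x => ?_, ?_⟩
  · rw [divergence_smul_const (hψs.differentiable (by simp) x),
      (hasFDerivAt_intervalIntegral_of_contDiff hgs 0 1 x).fderiv]
    -- Increasing `t` translates the bump along `w`, so its derivative in direction `w` is minus its
    -- `t`-derivative. The fundamental theorem of calculus then leaves only the bumps at the end
    -- points.
    have hd : ∀ t, HasDerivAt (fun t => -g x t) (fderiv ℝ (fun y => g y t) x w) t := fun t => by
      have h1 : fderiv ℝ (fun y => g y t) x = fderiv ℝ φ (x - (p + t • w)) :=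
        fderiv_comp_sub _
      have h2 : HasDerivAt (fun t : ℝ => x - (p + t • w)) (-w) t := by
        simpa using (((hasDerivAt_id t).smul_const w).const_add p).const_sub x
      have h3 := ((hφ.differentiable (by simp) (x - (p + t • w))).hasFDerivAt.comp_hasDerivAt
        t h2).neg
      rw [map_neg, neg_neg] at h3
      rw [h1]; exact h3
    have hc : Continuous fun t : ℝ => fderiv ℝ (fun y => g y t) x := by
      have h1 : (fun t : ℝ => fderiv ℝ (fun y => g y t) x)
          = fun t => fderiv ℝ φ (x - (p + t • w)) := funext fun t => fderiv_comp_sub _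
      rw [h1]
      exact (hφ.continuous_fderiv (by simp)).comp (by fun_prop)
    rw [ContinuousLinearMap.intervalIntegral_apply (hc.intervalIntegrable _ _),
      intervalIntegral.integral_eq_sub_of_hasDerivAt (fun t _ => hd t)
        ((hc.clm_apply continuous_const).intervalIntegrable _ _)]
    simp only [hg, hw]
    simp
    ring
  -- By Fubini, the pairing is the integral over `t` of the mean of `Λ · w` against a bump of mass
  -- one centred at `p + t • w`; each mean is within `ε` of the value at the centre.
  · have hK1 : ∀ t ∈ Ioc (0 : ℝ) 1, ∫ x in K, g x t = 1 := fun t ht => by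
      rw [setIntegral_eq_integral_of_forall_compl_eq_zero, ← hφ1]
      · exact integral_sub_right_eq_self φ (p + t • w)
      · intro x hx
        by_contra h
        exact hx (hgK x t ⟨ht.1.le, ht.2⟩ h)
    have hcont : ContinuousOn (fun z : (Fin d → ℝ) × ℝ => g z.1 z.2 * Λ z.1 w) (K ×ˢ Icc 0 1) :=
      hgs.continuous.continuousOn.mul (hΛw.comp continuousOn_fst fun z hz => hz.1)
    have hint : Integrable (Function.uncurry fun (x : Fin d → ℝ) (t : ℝ) => g x t * Λ x w)
        ((volume.restrict K).prod (volume.restrict (Ioc (0 : ℝ) 1))) := by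
      rw [Measure.prod_restrict]
      exact (hcont.integrableOn_compact (hKc.prod isCompact_Icc)).mono_set
        (prod_mono_right Ioc_subset_Icc_self)
    have h1 : ∫ x, Λ x (ψ x • w) = ∫ t in Ioc (0 : ℝ) 1, ∫ x in K, g x t * Λ x w := by
      rw [← integral_integral_swap hint, ← setIntegral_eq_integral_of_forall_compl_eq_zero
        (s := K) fun x hx => by simp [hψK x hx]]
      refine integral_congr_ae (Filter.Eventually.of_forall fun x => ?_)
      simp only [map_smul, smul_eq_mul, hψ, intervalIntegral.integral_of_le zero_le_one,
        integral_mul_const]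
    have hΛint : IntegrableOn (fun t : ℝ => Λ (p + t • w) w) (Ioc 0 1) := by
      refine IntegrableOn.mono_set (ContinuousOn.integrableOn_Icc ?_) Ioc_subset_Icc_self
      exact hΛw.comp (by fun_prop) fun t ht => self_subset_cthickening _ (hmem t ht)
    have hint' : IntegrableOn (fun t : ℝ => ∫ x in K, g x t * Λ x w) (Ioc 0 1) :=
      hint.integral_prod_right
    rw [h1, intervalIntegral.integral_of_le zero_le_one, ← integral_sub hint' hΛint]
    have hb : ∀ t ∈ Ioc (0 : ℝ) 1, ‖(∫ x in K, g x t * Λ x w) - Λ (p + t • w) w‖ ≤ ε := by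
      intro t ht
      have ht' : t ∈ Icc (0 : ℝ) 1 := ⟨ht.1.le, ht.2⟩
      have hgt : Continuous fun x => g x t :=
        hgs.continuous.comp (continuous_id.prodMk continuous_const)
      have hi1 : IntegrableOn (fun x => g x t * Λ x w) K :=
        (hgt.continuousOn.mul hΛw).integrableOn_compact hKc
      have hi2 : IntegrableOn (fun x => g x t) K := hgt.continuousOn.integrableOn_compact hKc
      have h2 : Λ (p + t • w) w = ∫ x in K, g x t * Λ (p + t • w) w := by
        rw [integral_mul_const, hK1 t ht, one_mul]
      rw [h2, ← integral_sub hi1 (hi2.mul_const _)]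
      calc _ ≤ ∫ x in K, g x t * ε := by
            refine norm_integral_le_of_norm_le (hi2.mul_const _)
              (ae_restrict_of_forall_mem hKc.measurableSet fun x hx => ?_)
            rw [← mul_sub, norm_mul, Real.norm_of_nonneg (hφ0 _)]
            by_cases h0 : g x t = 0
            · have h0' : φ (x - (p + t • w)) = 0 := h0
              simp [h0, h0']
            · refine mul_le_mul_of_nonneg_left ?_ (hφ0 _)
              rw [← dist_eq_norm]
              exact hu _ hx _ (self_subset_cthickening _ (hmem t ht'))
                ((hgd x t h0).le.trans (min_le_right _ _))
        _ = ε := by rw [integral_mul_const, hK1 t ht, one_mul]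
    have := norm_setIntegral_le_of_norm_le_const (μ := volume) (s := Ioc (0 : ℝ) 1) (by simp) hb
    simpa using this

end

/-! ### Exactness of one-forms that annihilate divergence-free fields. -/

noncomputable section

open MeasureTheory Set Metric

variable {d : ℕ}

/-- `PathIntegral Ω Λ p q c` says that `c` is the integral of the one-form `Λ` along some polygonal
path in `Ω` from `p` to `q`. -/
inductive PathIntegral (Ω : Set (Fin d → ℝ)) (Λ : (Fin d → ℝ) → (Fin d → ℝ) →L[ℝ] ℝ) :
    (Fin d → ℝ) → (Fin d → ℝ) → ℝ → Prop
  | refl (p : Fin d → ℝ) : PathIntegral Ω Λ p p 0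
  | segment {p q : Fin d → ℝ} : segment ℝ p q ⊆ Ω →
      PathIntegral Ω Λ p q (∫ t in (0 : ℝ)..1, Λ (p + t • (q - p)) (q - p))
  | symm {p q : Fin d → ℝ} {c : ℝ} : PathIntegral Ω Λ p q c → PathIntegral Ω Λ q p (-c)
  | trans {p q r : Fin d → ℝ} {c c' : ℝ} : PathIntegral Ω Λ p q c → PathIntegral Ω Λ q r c' →
      PathIntegral Ω Λ p r (c + c')

lemma integrable_form_apply {Ω : Set (Fin d → ℝ)} (hΩ : IsOpen Ω)
    {Λ : (Fin d → ℝ) → (Fin d → ℝ) →L[ℝ] ℝ} (hΛ : ContinuousOn Λ Ω)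
    {v : (Fin d → ℝ) → Fin d → ℝ} (hv : Continuous v) (hvc : HasCompactSupport v)
    (hvΩ : tsupport v ⊆ Ω) : Integrable fun x => Λ x (v x) := by
  have hsub : tsupport (fun x => Λ x (v x)) ⊆ tsupport v := by
    refine closure_mono fun x hx h => hx ?_
    simp [h]
  refine Continuous.integrable_of_hasCompactSupport ?_
    (hvc.of_isClosed_subset (isClosed_tsupport _) hsub)
  refine continuous_of_tsupport fun x hx => ?_
  exact (hΛ.continuousAt (hΩ.mem_nhds (hvΩ (hsub hx)))).clm_apply hv.continuousAt

/-- Reversing a path negates the field, and concatenation adds fields, the bumps at the common end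
point cancelling. As `δ` is fixed before `φ`, one bump can serve all segments of a path. -/
lemma PathIntegral.exists_field {Ω : Set (Fin d → ℝ)} (hΩ : IsOpen Ω)
    {Λ : (Fin d → ℝ) → (Fin d → ℝ) →L[ℝ] ℝ} (hΛ : ContinuousOn Λ Ω) {p q : Fin d → ℝ} {c : ℝ}
    (h : PathIntegral Ω Λ p q c) : ∀ ε > 0,
    ∃ δ > 0, ∀ φ : (Fin d → ℝ) → ℝ, ContDiff ℝ ∞ φ → (∀ x, 0 ≤ φ x) → ∫ x, φ x = 1 →
      Function.support φ ⊆ ball 0 δ →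
      ∃ v : (Fin d → ℝ) → Fin d → ℝ, ContDiff ℝ ∞ v ∧ HasCompactSupport v ∧ tsupport v ⊆ Ω ∧
        (∀ x, divergence v x = φ (x - p) - φ (x - q)) ∧ |(∫ x, Λ x (v x)) - c| ≤ ε := by
  induction h with
  | refl p =>
    refine fun ε hε => ⟨1, one_pos, fun φ _ _ _ _ => ⟨fun _ => 0, contDiff_const, ?_, ?_, ?_, ?_⟩⟩
    · exact HasCompactSupport.zero
    · simp [tsupport]
    · simp [divergence]
    · simpa using hε.le
  | segment hpq => exact fun ε hε => exists_field_along_segment hΩ hΛ hpq hε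
  | symm _ ih =>
    intro ε hε
    obtain ⟨δ, hδ, H⟩ := ih ε hε
    refine ⟨δ, hδ, fun φ h1 h2 h3 h4 => ?_⟩
    obtain ⟨v, hv, hvc, hvΩ, hdiv, hint⟩ := H φ h1 h2 h3 h4
    refine ⟨fun x => -v x, hv.neg, hvc.comp_left (g := Neg.neg) neg_zero, ?_, fun x => ?_, ?_⟩
    · rwa [show (fun x => -v x) = -v from rfl, tsupport_neg]
    · have : divergence (fun x => -v x) x = -divergence v x := by
        simp [divergence, fderiv_fun_neg]
      rw [this, hdiv]; ring
    · simp only [map_neg, integral_neg]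
      rwa [← abs_neg, neg_sub, sub_neg_eq_add, neg_add_eq_sub, ← abs_neg, neg_sub, abs_sub_comm]
  | trans _ _ ih ih' =>
    intro ε hε
    obtain ⟨δ, hδ, H⟩ := ih (ε / 2) (half_pos hε)
    obtain ⟨δ', hδ', H'⟩ := ih' (ε / 2) (half_pos hε)
    refine ⟨min δ δ', lt_min hδ hδ', fun φ h1 h2 h3 h4 => ?_⟩
    obtain ⟨v, hv, hvc, hvΩ, hdiv, hint⟩ :=
      H φ h1 h2 h3 (h4.trans (ball_subset_ball (min_le_left _ _)))
    obtain ⟨w, hw, hwc, hwΩ, hdiw, hinw⟩ :=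
      H' φ h1 h2 h3 (h4.trans (ball_subset_ball (min_le_right _ _)))
    refine ⟨fun x => v x + w x, hv.add hw, hvc.add hwc,
      (tsupport_add v w).trans (union_subset hvΩ hwΩ), fun x => ?_, ?_⟩
    · rw [divergence_add (hv.differentiable (by simp) x) (hw.differentiable (by simp) x), hdiv,
        hdiw]
      ring
    · simp only [map_add]
      rw [integral_add (integrable_form_apply hΩ hΛ hv.continuous hvc hvΩ)
        (integrable_form_apply hΩ hΛ hw.continuous hwc hwΩ), add_sub_add_comm]
      exact (abs_add_le _ _).trans (by linarith)

/-- A one-form that annihilates the compactly supported divergence-free fields has no periods. -/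
lemma PathIntegral.eq_zero {Ω : Set (Fin d → ℝ)} (hΩ : IsOpen Ω)
    {Λ : (Fin d → ℝ) → (Fin d → ℝ) →L[ℝ] ℝ} (hΛ : ContinuousOn Λ Ω)
    (H : ∀ v : (Fin d → ℝ) → Fin d → ℝ, ContDiff ℝ ∞ v → HasCompactSupport v → tsupport v ⊆ Ω →
      (∀ x, divergence v x = 0) → ∫ x, Λ x (v x) = 0)
    {p : Fin d → ℝ} {c : ℝ} (h : PathIntegral Ω Λ p p c) : c = 0 := by
  refine abs_nonpos_iff.1 (le_of_forall_pos_le_add fun ε hε => ?_)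
  obtain ⟨δ, hδ, hφ⟩ := h.exists_field hΩ hΛ ε hε
  let b : ContDiffBump (0 : Fin d → ℝ) := ⟨δ / 2, δ, half_pos hδ, half_lt_self hδ⟩
  obtain ⟨v, hv, hvc, hvΩ, hdiv, hint⟩ := hφ (b.normed volume) b.contDiff_normed
    (fun x => b.nonneg_normed x) b.integral_normed b.support_normed_eq.subset
  -- On a closed path the two end-point bumps coincide, so `v` is divergence-free and its pairing
  -- with `Λ` is zero.
  rw [H v hv hvc hvΩ fun x => by rw [hdiv, sub_self], zero_sub, abs_neg] at hint
  simpa using hint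

/-- A base point is chosen in each class of points joined by polygonal paths, and `f` integrates
from it; thus `Ω` need not be connected. Points outside `Ω` are classes by themselves. Independence
of the path is the vanishing of periods. -/
lemma exists_primitive_pathIntegral {Ω : Set (Fin d → ℝ)} (hΩ : IsOpen Ω)
    {Λ : (Fin d → ℝ) → (Fin d → ℝ) →L[ℝ] ℝ} (hΛ : ContinuousOn Λ Ω)
    (H : ∀ v : (Fin d → ℝ) → Fin d → ℝ, ContDiff ℝ ∞ v → HasCompactSupport v → tsupport v ⊆ Ω →
      (∀ x, divergence v x = 0) → ∫ x, Λ x (v x) = 0) :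
    ∃ f : (Fin d → ℝ) → ℝ, ∀ p q c, PathIntegral Ω Λ p q c → f q - f p = c := by
  let S : Setoid (Fin d → ℝ) :=
    { r := fun p q => ∃ c, PathIntegral Ω Λ p q c
      iseqv := ⟨fun p => ⟨0, .refl p⟩, fun ⟨c, h⟩ => ⟨-c, h.symm⟩,
        fun ⟨c, h⟩ ⟨c', h'⟩ => ⟨c + c', h.trans h'⟩⟩ }
  have hrep : ∀ p, ∃ c, PathIntegral Ω Λ (Quotient.mk S p).out p c := fun p =>
    Quotient.exact (s := S) (Quotient.out_eq _)
  choose f hf using hrep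
  refine ⟨f, fun p q c h => ?_⟩
  have hpq : Quotient.mk S p = Quotient.mk S q := Quotient.sound (s := S) ⟨c, h⟩
  have hq := hf q
  rw [← hpq] at hq
  have := (((hf p).trans h).trans hq.symm).eq_zero hΩ hΛ H
  linarith

/-- A smooth one-form on an open set that annihilates all compactly supported divergence-free vector
fields is exact. -/
theorem exists_primitive_of_integral_divergenceFree_eq_zero {Ω : Set (Fin d → ℝ)} (hΩ : IsOpen Ω)
    {Λ : (Fin d → ℝ) → (Fin d → ℝ) →L[ℝ] ℝ} (hΛ : ContDiffOn ℝ ∞ Λ Ω)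
    (H : ∀ v : (Fin d → ℝ) → Fin d → ℝ, ContDiff ℝ ∞ v → HasCompactSupport v → tsupport v ⊆ Ω →
      (∀ x, divergence v x = 0) → ∫ x, Λ x (v x) = 0) :
    ∃ f : (Fin d → ℝ) → ℝ, ContDiffOn ℝ ∞ f Ω ∧ ∀ x ∈ Ω, HasFDerivAt f (Λ x) x := by
  obtain ⟨f, hf⟩ := exists_primitive_pathIntegral hΩ hΛ.continuousOn H
  have hd : ∀ x ∈ Ω, HasFDerivAt f (Λ x) x := by
    intro x hx
    rw [hasFDerivAt_iff_isLittleO, Asymptotics.isLittleO_iff]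
    intro ε hε
    obtain ⟨r, hr, hrΩ⟩ := Metric.isOpen_iff.1 hΩ x hx
    obtain ⟨r', hr', hrΛ⟩ := Metric.continuousAt_iff.1
      (hΛ.continuousOn.continuousAt (hΩ.mem_nhds hx)) ε hε
    filter_upwards [ball_mem_nhds x (lt_min hr hr')] with y hy
    have hseg : segment ℝ x y ⊆ ball x (min r r') :=
      (convex_ball x _).segment_subset (mem_ball_self (lt_min hr hr')) hy
    have hmem : ∀ t ∈ Icc (0 : ℝ) 1, x + t • (y - x) ∈ segment ℝ x y := fun t ht => by
      rw [segment_eq_image']; exact ⟨t, ht, rfl⟩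
    have hsegΩ : segment ℝ x y ⊆ Ω := hseg.trans ((ball_subset_ball (min_le_left _ _)).trans hrΩ)
    have hc : ContinuousOn (fun t : ℝ => Λ (x + t • (y - x)) (y - x)) (uIcc 0 1) := by
      rw [uIcc_of_le zero_le_one]
      exact (hΛ.continuousOn.comp (by fun_prop) fun t ht => hsegΩ (hmem t ht)).clm_apply
        continuousOn_const
    -- Near `x` the increment of `f` is the integral along the straight segment, so the remainder is
    -- the integral of `(Λ (x + t • (y - x)) - Λ x) (y - x)`, small by continuity of `Λ`.
    rw [hf x y _ (.segment hsegΩ)]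
    have h1 : Λ x (y - x) = ∫ t in (0 : ℝ)..1, Λ x (y - x) := by simp
    rw [h1, ← intervalIntegral.integral_sub hc.intervalIntegrable intervalIntegrable_const]
    refine (intervalIntegral.norm_integral_le_of_norm_le_const (C := ε * ‖y - x‖) fun t ht => ?_
      ).trans (by simp)
    rw [uIoc_of_le zero_le_one] at ht
    rw [← sub_apply]
    refine (ContinuousLinearMap.le_opNorm _ _).trans
      (mul_le_mul_of_nonneg_right ?_ (norm_nonneg _))
    rw [← dist_eq_norm]
    exact (hrΛ (lt_of_lt_of_le (hseg (hmem t ⟨ht.1.le, ht.2⟩)) (min_le_right _ _))).le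
  refine ⟨f, ?_, hd⟩
  rw [contDiffOn_infty_iff_fderiv_of_isOpen hΩ]
  exact ⟨fun x hx => (hd x hx).differentiableAt.differentiableWithinAt,
    hΛ.congr fun x hx => (hd x hx).fderiv⟩

end

/-! ### Coordinate calculus, the field strength and the Bianchi identity. -/

noncomputable section

namespace YangMills

variable {n : ℕ} {Ω : Set Spacetime}

section Calculus

variable {V W : Type*} [NormedAddCommGroup V] [NormedSpace ℝ V] [NormedAddCommGroup W]
  [NormedSpace ℝ W] {x : Spacetime}

lemma partialD_add (μ : Fin 4) {φ ψ : Spacetime → V} (hφ : DifferentiableAt ℝ φ x)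
    (hψ : DifferentiableAt ℝ ψ x) :
    partialD μ (fun y => φ y + ψ y) x = partialD μ φ x + partialD μ ψ x := by
  simp only [partialD, fderiv_fun_add hφ hψ]; rfl

lemma partialD_sub (μ : Fin 4) {φ ψ : Spacetime → V} (hφ : DifferentiableAt ℝ φ x)
    (hψ : DifferentiableAt ℝ ψ x) :
    partialD μ (fun y => φ y - ψ y) x = partialD μ φ x - partialD μ ψ x := by
  simp only [partialD, fderiv_fun_sub hφ hψ]; rfl

lemma partialD_const_smul (μ : Fin 4) {φ : Spacetime → V} (hφ : DifferentiableAt ℝ φ x) (c : ℝ) :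
    partialD μ (fun y => c • φ y) x = c • partialD μ φ x := by
  simp only [partialD, fderiv_fun_const_smul hφ]; rfl

lemma partialD_const_mul (μ : Fin 4) {φ : Spacetime → ℝ} (hφ : DifferentiableAt ℝ φ x) (c : ℝ) :
    partialD μ (fun y => c * φ y) x = c * partialD μ φ x :=
  partialD_const_smul μ hφ c

lemma partialD_mul (μ : Fin 4) {φ ψ : Spacetime → ℝ} (hφ : DifferentiableAt ℝ φ x)
    (hψ : DifferentiableAt ℝ ψ x) :
    partialD μ (fun y => φ y * ψ y) x = partialD μ φ x * ψ x + φ x * partialD μ ψ x := by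
  simp only [partialD, fderiv_fun_mul hφ hψ]
  simp [mul_comm, add_comm]

lemma partialD_sum {ι : Type*} (s : Finset ι) (μ : Fin 4) {φ : ι → Spacetime → V}
    (hφ : ∀ i ∈ s, DifferentiableAt ℝ (φ i) x) :
    partialD μ (fun y => ∑ i ∈ s, φ i y) x = ∑ i ∈ s, partialD μ (φ i) x := by
  simp only [partialD, fderiv_fun_sum hφ]; simp

lemma partialD_bilinear {V' : Type*} [NormedAddCommGroup V'] [NormedSpace ℝ V']
    (B : V →L[ℝ] W →L[ℝ] V') (μ : Fin 4) {φ : Spacetime → V} {ψ : Spacetime → W}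
    (hφ : DifferentiableAt ℝ φ x) (hψ : DifferentiableAt ℝ ψ x) :
    partialD μ (fun y => B (φ y) (ψ y)) x
      = B (partialD μ φ x) (ψ x) + B (φ x) (partialD μ ψ x) := by
  simp only [partialD, B.fderiv_of_bilinear hφ hψ]
  simp [add_comm]

lemma partialD_comm (hΩ : IsOpen Ω) {φ : Spacetime → V} (hφ : ContDiffOn ℝ ∞ φ Ω) (hx : x ∈ Ω)
    (μ ν : Fin 4) : partialD μ (partialD ν φ) x = partialD ν (partialD μ φ) x := by
  have hc : ContDiffAt ℝ ∞ φ x := hφ.contDiffAt (hΩ.mem_nhds hx)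
  have hs := hc.isSymmSndFDerivAt (by simpa using WithTop.coe_le_coe.2 (le_top : (2 : ℕ∞) ≤ ⊤))
  have hd : DifferentiableAt ℝ (fderiv ℝ φ) x :=
    (hc.fderiv_right (m := ∞) (by simp)).differentiableAt (by simp)
  have h : ∀ ρ σ, partialD ρ (partialD σ φ) x
      = fderiv ℝ (fderiv ℝ φ) x (Pi.single ρ 1) (Pi.single σ 1) := fun ρ σ => by
    change fderiv ℝ (fun y => fderiv ℝ φ y (Pi.single σ 1)) x (Pi.single ρ 1) = _
    rw [fderiv_clm_apply hd (differentiableAt_const _)]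
    simp
  rw [h, h, hs.eq]

lemma contDiffOn_partialD (hΩ : IsOpen Ω) {φ : Spacetime → V} (hφ : ContDiffOn ℝ ∞ φ Ω)
    (μ : Fin 4) : ContDiffOn ℝ ∞ (partialD μ φ) Ω :=
  (hφ.fderiv_of_isOpen hΩ (by simp)).clm_apply contDiffOn_const

lemma contDiffOn_bilinear {V' : Type*} [NormedAddCommGroup V'] [NormedSpace ℝ V']
    (B : V →L[ℝ] W →L[ℝ] V') {φ : Spacetime → V} {ψ : Spacetime → W}
    (hφ : ContDiffOn ℝ ∞ φ Ω) (hψ : ContDiffOn ℝ ∞ ψ Ω) :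
    ContDiffOn ℝ ∞ (fun y => B (φ y) (ψ y)) Ω :=
  (B.contDiff.comp_contDiffOn hφ).clm_apply hψ

lemma partialD_of_not_differentiableAt (μ : Fin 4) {φ : Spacetime → V}
    (hφ : ¬DifferentiableAt ℝ φ x) : partialD μ φ x = 0 := by
  rw [partialD, fderiv_zero_of_not_differentiableAt hφ]; rfl

lemma contDiffOn_lie {X Y : Spacetime → Matrix (Fin n) (Fin n) ℂ} (hX : ContDiffOn ℝ ∞ X Ω)
    (hY : ContDiffOn ℝ ∞ Y Ω) : ContDiffOn ℝ ∞ (fun y => ⁅X y, Y y⁆) Ω :=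
  contDiffOn_bilinear (lieL n) hX hY

lemma contDiffOn_trForm {X Y : Spacetime → Matrix (Fin n) (Fin n) ℂ} (hX : ContDiffOn ℝ ∞ X Ω)
    (hY : ContDiffOn ℝ ∞ Y Ω) : ContDiffOn ℝ ∞ (fun y => trForm (X y) (Y y)) Ω :=
  contDiffOn_bilinear (trFormL n) hX hY

lemma partialD_lie (μ : Fin 4) {X Y : Spacetime → Matrix (Fin n) (Fin n) ℂ}
    (hX : DifferentiableAt ℝ X x) (hY : DifferentiableAt ℝ Y x) :
    partialD μ (fun y => ⁅X y, Y y⁆) x = ⁅partialD μ X x, Y x⁆ + ⁅X x, partialD μ Y x⁆ :=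
  partialD_bilinear (lieL n) μ hX hY

lemma partialD_trForm (μ : Fin 4) {X Y : Spacetime → Matrix (Fin n) (Fin n) ℂ}
    (hX : DifferentiableAt ℝ X x) (hY : DifferentiableAt ℝ Y x) :
    partialD μ (fun y => trForm (X y) (Y y)) x
      = trForm (partialD μ X x) (Y x) + trForm (X x) (partialD μ Y x) :=
  partialD_bilinear (trFormL n) μ hX hY

lemma differentiableAt_of_contDiffOn (hΩ : IsOpen Ω) {φ : Spacetime → V}
    (hφ : ContDiffOn ℝ ∞ φ Ω) (hx : x ∈ Ω) : DifferentiableAt ℝ φ x :=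
  (hφ.contDiffAt (hΩ.mem_nhds hx)).differentiableAt (by simp)

-- A finite-dimensional subspace is closed, so it contains limits of difference quotients. Without
-- differentiability the derivative has the default value zero, which also lies in `S`.
open Filter Topology in
lemma partialD_mem (S : Submodule ℝ (Matrix (Fin n) (Fin n) ℂ)) (hΩ : IsOpen Ω)
    {X : Spacetime → Matrix (Fin n) (Fin n) ℂ} (hX : ∀ y ∈ Ω, X y ∈ S) (hx : x ∈ Ω) (μ : Fin 4) :
    partialD μ X x ∈ S := by
  by_cases hd : DifferentiableAt ℝ X x
  · have hl : HasDerivAt (fun t : ℝ => X (x + t • Pi.single μ 1)) (partialD μ X x) 0 :=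
      hd.hasFDerivAt.hasLineDerivAt _
    have ht := hasDerivAt_iff_tendsto_slope.1 hl
    refine (Submodule.closed_of_finiteDimensional S).mem_of_tendsto ht ?_
    have hev : ∀ᶠ t : ℝ in 𝓝 0, x + t • (Pi.single μ 1 : Spacetime) ∈ Ω := by
      have hc : ContinuousAt (fun t : ℝ => x + t • (Pi.single μ 1 : Spacetime)) 0 := by fun_prop
      exact hc.eventually_mem (hΩ.mem_nhds (by simpa using hx))
    filter_upwards [hev.filter_mono nhdsWithin_le_nhds] with t ht
    rw [slope_def_module]
    refine S.smul_mem _ (S.sub_mem (hX _ ht) (hX _ ?_))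
    simpa using hx
  · exact (partialD_of_not_differentiableAt μ hd).symm ▸ S.zero_mem

/-- Every point is either in `Ω`, where smoothness is given, or off the closed support, where `φ` is
locally zero. -/
lemma contDiff_of_contDiffOn_of_tsupport (hΩ : IsOpen Ω) {φ : Spacetime → V}
    (hφ : ContDiffOn ℝ ∞ φ Ω) (hs : tsupport φ ⊆ Ω) : ContDiff ℝ ∞ φ := by
  rw [contDiff_iff_contDiffAt]
  intro x
  by_cases hx : x ∈ tsupport φ
  · exact hφ.contDiffAt (hΩ.mem_nhds (hs hx))
  · exact contDiffAt_const.congr_of_eventuallyEq (notMem_tsupport_iff_eventuallyEq.1 hx)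

open MeasureTheory in
lemma integral_partialD_eq_zero {φ : Spacetime → ℝ} (hφ : ContDiff ℝ ∞ φ)
    (hc : HasCompactSupport φ) (μ : Fin 4) : ∫ x, partialD μ φ x = 0 := by
  have h1 : Continuous fun x => fderiv ℝ φ x (Pi.single μ 1) :=
    (hφ.continuous_fderiv (by simp)).clm_apply continuous_const
  have h := integral_mul_fderiv_eq_neg_fderiv_mul_of_integrable (μ := volume)
    (f := fun _ : Spacetime => (1 : ℝ)) (g := φ) (v := Pi.single μ 1) (by simp)
    (by simpa using h1.integrable_of_hasCompactSupport (hc.fderiv_apply ℝ _))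
    (by simpa using hφ.continuous.integrable_of_hasCompactSupport hc)
    (fun _ _ => differentiableAt_const _) (fun x _ => hφ.differentiable (by simp) x)
  simpa [partialD] using h

end Calculus

section FieldStrength

variable {A a : GaugeField n} {x : Spacetime}

lemma contDiffOn_component (hA : ContDiffOn ℝ ∞ A Ω) (μ : Fin 4) :
    ContDiffOn ℝ ∞ (fun y => A y μ) Ω :=
  contDiffOn_pi.1 hA μ

lemma contDiffOn_fieldStrength (hΩ : IsOpen Ω) (hA : ContDiffOn ℝ ∞ A Ω) (μ ν : Fin 4) :
    ContDiffOn ℝ ∞ (fun y => fieldStrength A y μ ν) Ω :=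
  ((contDiffOn_partialD hΩ (contDiffOn_component hA ν) μ).sub
    (contDiffOn_partialD hΩ (contDiffOn_component hA μ) ν)).add
    (contDiffOn_lie (contDiffOn_component hA μ) (contDiffOn_component hA ν))

lemma fieldStrength_mem (𝔤 : LieSubalgebra ℝ (Matrix (Fin n) (Fin n) ℂ)) (hΩ : IsOpen Ω)
    (hA : ∀ y ∈ Ω, ∀ μ, A y μ ∈ 𝔤) (hx : x ∈ Ω) (μ ν : Fin 4) : fieldStrength A x μ ν ∈ 𝔤 := by
  have h := fun μ ν => partialD_mem 𝔤.toSubmodule hΩ (fun y hy => hA y hy ν) hx μ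
  exact add_mem (sub_mem (h μ ν) (h ν μ)) (𝔤.lie_mem (hA x hx μ) (hA x hx ν))

lemma fieldStrength_antisymm (A : GaugeField n) (x : Spacetime) (μ ν : Fin 4) :
    fieldStrength A x ν μ = -fieldStrength A x μ ν := by
  rw [fieldStrength, fieldStrength, ← lie_skew (A x μ)]; abel

/-- The Yang–Mills current `D^ν F_{μν}`. -/
def current (A : GaugeField n) (x : Spacetime) (μ : Fin 4) : Matrix (Fin n) (Fin n) ℂ :=
  ∑ ν, eta ν • covD A ν μ ν x

lemma contDiffOn_current (hΩ : IsOpen Ω) (hA : ContDiffOn ℝ ∞ A Ω) (μ : Fin 4) :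
    ContDiffOn ℝ ∞ (fun y => current A y μ) Ω :=
  ContDiffOn.sum fun ν _ => ContDiffOn.const_smul _
    ((contDiffOn_partialD hΩ (contDiffOn_fieldStrength hΩ hA μ ν) ν).add
      (contDiffOn_lie (contDiffOn_component hA ν) (contDiffOn_fieldStrength hΩ hA μ ν)))

lemma current_mem (𝔤 : LieSubalgebra ℝ (Matrix (Fin n) (Fin n) ℂ)) (hΩ : IsOpen Ω)
    (hA : ∀ y ∈ Ω, ∀ μ, A y μ ∈ 𝔤) (hx : x ∈ Ω) (μ : Fin 4) : current A x μ ∈ 𝔤 :=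
  sum_mem fun ν _ => 𝔤.smul_mem _ (add_mem
    (partialD_mem 𝔤.toSubmodule hΩ (fun _ hy => fieldStrength_mem 𝔤 hΩ hA hy μ ν) hx ν)
    (𝔤.lie_mem (hA x hx ν) (fieldStrength_mem 𝔤 hΩ hA hx μ ν)))

/-- The **Bianchi identity**. -/
lemma covD_cyclic (hΩ : IsOpen Ω) (hA : ContDiffOn ℝ ∞ A Ω) (hx : x ∈ Ω) (μ α β : Fin 4) :
    covD A μ α β x + covD A α β μ x + covD A β μ α x = 0 := by
  have hc := fun μ => contDiffOn_component hA μ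
  have hd := fun μ => differentiableAt_of_contDiffOn hΩ (hc μ) hx
  have hdd := fun μ ν =>
    differentiableAt_of_contDiffOn hΩ (contDiffOn_partialD hΩ (hc ν) μ) hx
  have hF : ∀ μ α β, partialD μ (fun y => fieldStrength A y α β) x
      = partialD μ (partialD α fun y => A y β) x - partialD μ (partialD β fun y => A y α) x
        + (⁅partialD μ (fun y => A y α) x, A x β⁆ + ⁅A x α, partialD μ (fun y => A y β) x⁆) := by
    intro μ α β
    have hl := differentiableAt_of_contDiffOn hΩ (contDiffOn_lie (hc α) (hc β)) hx
    rw [← partialD_lie μ (hd α) (hd β), ← partialD_sub μ (hdd α β) (hdd β α),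
      ← partialD_add μ ((hdd α β).fun_sub (hdd β α)) hl]
    rfl
  -- Second derivatives cancel in pairs by symmetry; the rest, Jacobi identity included, is an
  -- identity between noncommutative polynomials.
  have hs := fun μ ν ρ => partialD_comm hΩ (hc ρ) hx μ ν
  simp only [covD, hF]
  rw [hs μ α β, hs β μ α, hs α β μ]
  simp only [fieldStrength, Ring.lie_def]
  noncomm_ring

end FieldStrength

end YangMills

end

/-! ### First variations of the two densities. -/

noncomputable section

namespace YangMills

variable {n : ℕ} {Ω : Set Spacetime} {A a : GaugeField n} {x : Spacetime}

/-- The first variation `δF_{μν} = D_μ δA_ν - D_ν δA_μ` of the field strength. -/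
def fieldVariation (A a : GaugeField n) (x : Spacetime) (μ ν : Fin 4) :
    Matrix (Fin n) (Fin n) ℂ :=
  partialD μ (fun y => a y ν) x - partialD ν (fun y => a y μ) x + (⁅A x μ, a x ν⁆ + ⁅a x μ, A x ν⁆)

lemma fieldVariation_eq (A a : GaugeField n) (x : Spacetime) (μ ν : Fin 4) :
    fieldVariation A a x μ ν = (partialD μ (fun y => a y ν) x + ⁅A x μ, a x ν⁆)
      - (partialD ν (fun y => a y μ) x + ⁅A x ν, a x μ⁆) := by
  rw [fieldVariation, ← lie_skew (a x μ)]; abel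

/-- The expansion in `s` is exact, so both densities are quartic polynomials in `s`. -/
lemma fieldStrength_add_smul (hΩ : IsOpen Ω) (hA : ContDiffOn ℝ ∞ A Ω) (ha : ContDiffOn ℝ ∞ a Ω)
    (hx : x ∈ Ω) (s : ℝ) (μ ν : Fin 4) :
    fieldStrength (A + s • a) x μ ν
      = fieldStrength A x μ ν + s • fieldVariation A a x μ ν + s ^ 2 • ⁅a x μ, a x ν⁆ := by
  have hp : ∀ μ ν, partialD μ (fun y => (A + s • a) y ν) x
      = partialD μ (fun y => A y ν) x + s • partialD μ (fun y => a y ν) x := by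
    intro μ ν
    have h1 := differentiableAt_of_contDiffOn hΩ (contDiffOn_component hA ν) hx
    have h2 := differentiableAt_of_contDiffOn hΩ (contDiffOn_component ha ν) hx
    rw [← partialD_const_smul μ h2, ← partialD_add μ h1 (h2.fun_const_smul s)]
    rfl
  simp only [fieldStrength, hp]
  simp only [fieldVariation, Pi.add_apply, Pi.smul_apply, Ring.lie_def, add_mul,
    mul_add, Matrix.smul_mul, Matrix.mul_smul]
  module

lemma contDiffOn_fieldVariation (hΩ : IsOpen Ω) (hA : ContDiffOn ℝ ∞ A Ω)
    (ha : ContDiffOn ℝ ∞ a Ω) (μ ν : Fin 4) :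
    ContDiffOn ℝ ∞ (fun y => fieldVariation A a y μ ν) Ω :=
  ((contDiffOn_partialD hΩ (contDiffOn_component ha ν) μ).sub
    (contDiffOn_partialD hΩ (contDiffOn_component ha μ) ν)).add
    ((contDiffOn_lie (contDiffOn_component hA μ) (contDiffOn_component ha ν)).add
      (contDiffOn_lie (contDiffOn_component ha μ) (contDiffOn_component hA ν)))

/-- The bilinear form `w^{μναβ} tr (P_{μν} Q_{αβ})` on matrix-valued tensors. -/
def pairing (w : Fin 4 → Fin 4 → Fin 4 → Fin 4 → ℝ)
    (P Q : Fin 4 → Fin 4 → Matrix (Fin n) (Fin n) ℂ) : ℝ :=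
  ∑ μ, ∑ ν, ∑ α, ∑ β, w μ ν α β * trForm (P μ ν) (Q α β)

lemma pairing_expand (w : Fin 4 → Fin 4 → Fin 4 → Fin 4 → ℝ)
    (F G H : Fin 4 → Fin 4 → Matrix (Fin n) (Fin n) ℂ) (s : ℝ) :
    pairing w (fun μ ν => F μ ν + s • G μ ν + s ^ 2 • H μ ν)
        (fun μ ν => F μ ν + s • G μ ν + s ^ 2 • H μ ν)
      = pairing w F F + s * (pairing w F G + pairing w G F)
        + s ^ 2 * (pairing w F H + pairing w G G + pairing w H F)
        + s ^ 3 * (pairing w G H + pairing w H G) + s ^ 4 * pairing w H H := by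
  simp only [pairing, Finset.mul_sum, ← Finset.sum_add_distrib]
  refine Finset.sum_congr rfl fun μ _ => Finset.sum_congr rfl fun ν _ =>
    Finset.sum_congr rfl fun α _ => Finset.sum_congr rfl fun β _ => ?_
  simp only [trForm_add_left, trForm_add_right, trForm_smul_left, trForm_smul_right]
  ring

lemma contDiffOn_pairing (w : Fin 4 → Fin 4 → Fin 4 → Fin 4 → ℝ)
    {P Q : Spacetime → Fin 4 → Fin 4 → Matrix (Fin n) (Fin n) ℂ}
    (hP : ∀ μ ν, ContDiffOn ℝ ∞ (fun y => P y μ ν) Ω)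
    (hQ : ∀ μ ν, ContDiffOn ℝ ∞ (fun y => Q y μ ν) Ω) :
    ContDiffOn ℝ ∞ (fun y => pairing w (P y) (Q y)) Ω :=
  ContDiffOn.sum fun μ _ => ContDiffOn.sum fun ν _ => ContDiffOn.sum fun α _ =>
    ContDiffOn.sum fun β _ => contDiffOn_const.mul (contDiffOn_trForm (hP μ ν) (hQ α β))

lemma hasDerivAt_quartic (c₀ c₁ c₂ c₃ c₄ : ℝ) :
    HasDerivAt (fun s : ℝ => c₀ + s * c₁ + s ^ 2 * c₂ + s ^ 3 * c₃ + s ^ 4 * c₄) c₁ 0 := by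
  have h := (((((hasDerivAt_id (0 : ℝ)).mul_const c₁).const_add c₀).fun_add
    ((hasDerivAt_pow 2 (0 : ℝ)).mul_const c₂)).fun_add
    ((hasDerivAt_pow 3 (0 : ℝ)).mul_const c₃)).fun_add
    ((hasDerivAt_pow 4 (0 : ℝ)).mul_const c₄)
  simpa using h

-- Integrating the coefficients gives a polynomial in `s`, so no domination argument is needed to
-- differentiate under the integral.
open MeasureTheory in
lemma hasDerivAt_integral_quartic {K : Set Spacetime} (hK : IsCompact K)
    {c₀ c₁ c₂ c₃ c₄ : Spacetime → ℝ} (h₀ : ContinuousOn c₀ K) (h₁ : ContinuousOn c₁ K)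
    (h₂ : ContinuousOn c₂ K) (h₃ : ContinuousOn c₃ K) (h₄ : ContinuousOn c₄ K)
    {p : ℝ → Spacetime → ℝ} (hp : ∀ s, ∀ x ∈ K,
      p s x = c₀ x + s * c₁ x + s ^ 2 * c₂ x + s ^ 3 * c₃ x + s ^ 4 * c₄ x) :
    HasDerivAt (fun s => ∫ x in K, p s x) (∫ x in K, c₁ x) 0 := by
  refine (hasDerivAt_quartic (∫ x in K, c₀ x) (∫ x in K, c₁ x) (∫ x in K, c₂ x) (∫ x in K, c₃ x)
    (∫ x in K, c₄ x)).congr_of_eventuallyEq (Filter.Eventually.of_forall fun s => ?_)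
  have i₀ : IntegrableOn c₀ K := h₀.integrableOn_compact hK
  have i₁ : IntegrableOn (fun x => s * c₁ x) K := (h₁.integrableOn_compact hK).const_mul _
  have i₂ : IntegrableOn (fun x => s ^ 2 * c₂ x) K := (h₂.integrableOn_compact hK).const_mul _
  have i₃ : IntegrableOn (fun x => s ^ 3 * c₃ x) K := (h₃.integrableOn_compact hK).const_mul _
  have i₄ : IntegrableOn (fun x => s ^ 4 * c₄ x) K := (h₄.integrableOn_compact hK).const_mul _
  have j₁ : IntegrableOn (fun x => c₀ x + s * c₁ x) K := i₀.add i₁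
  have j₂ : IntegrableOn (fun x => c₀ x + s * c₁ x + s ^ 2 * c₂ x) K := j₁.add i₂
  have j₃ : IntegrableOn (fun x => c₀ x + s * c₁ x + s ^ 2 * c₂ x + s ^ 3 * c₃ x) K := j₂.add i₃
  simp only
  rw [setIntegral_congr_fun hK.measurableSet (hp s), integral_add j₃ i₄, integral_add j₂ i₃,
    integral_add j₁ i₂, integral_add i₀ i₁]
  simp only [integral_const_mul]

/-- The first variation of a weighted integral of a quadratic form in the field strength. -/
lemma hasDerivAt_integral_pairing (hΩ : IsOpen Ω) (hA : ContDiffOn ℝ ∞ A Ω)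
    (ha : ContDiffOn ℝ ∞ a Ω) {K : Set Spacetime} (hK : IsCompact K) (hKΩ : K ⊆ Ω)
    {g : Spacetime → ℝ} (hg : ContinuousOn g K) (w : Fin 4 → Fin 4 → Fin 4 → Fin 4 → ℝ) :
    HasDerivAt (fun s : ℝ => ∫ x in K, g x * pairing w (fieldStrength (A + s • a) x)
        (fieldStrength (A + s • a) x))
      (∫ x in K, g x * (pairing w (fieldStrength A x) (fieldVariation A a x)
        + pairing w (fieldVariation A a x) (fieldStrength A x))) 0 := by
  have hF := contDiffOn_fieldStrength hΩ hA
  have hG := contDiffOn_fieldVariation hΩ hA ha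
  have hH : ∀ μ ν, ContDiffOn ℝ ∞ (fun y => ⁅a y μ, a y ν⁆) Ω := fun μ ν =>
    contDiffOn_lie (contDiffOn_component ha μ) (contDiffOn_component ha ν)
  have hc : ∀ {P Q : Spacetime → Fin 4 → Fin 4 → Matrix (Fin n) (Fin n) ℂ},
      (∀ μ ν, ContDiffOn ℝ ∞ (fun y => P y μ ν) Ω) → (∀ μ ν, ContDiffOn ℝ ∞ (fun y => Q y μ ν) Ω) →
      ContinuousOn (fun y => pairing w (P y) (Q y)) K := fun hP hQ =>
    (contDiffOn_pairing w hP hQ).continuousOn.mono hKΩ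
  refine hasDerivAt_integral_quartic hK (hg.mul (hc hF hF)) (hg.mul ((hc hF hG).add (hc hG hF)))
    (hg.mul (((hc hF hH).add (hc hG hG)).add (hc hH hF))) (hg.mul ((hc hG hH).add (hc hH hG)))
    (hg.mul (hc hH hH)) fun s x hx => ?_
  have h : fieldStrength (A + s • a) x = fun μ ν =>
      fieldStrength A x μ ν + s • fieldVariation A a x μ ν + s ^ 2 • ⁅a x μ, a x ν⁆ := by
    funext μ ν; exact fieldStrength_add_smul hΩ hA ha (hKΩ hx) s μ ν
  rw [h, pairing_expand]
  simp only [Pi.mul_apply, Pi.add_apply]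
  ring

lemma epsFF_eq_pairing (A : GaugeField n) (x : Spacetime) :
    epsFF A x = pairing epsUpper (fieldStrength A x) (fieldStrength A x) := rfl

lemma hasDerivAt_epsFF (hΩ : IsOpen Ω) (hA : ContDiffOn ℝ ∞ A Ω) (ha : ContDiffOn ℝ ∞ a Ω)
    (hx : x ∈ Ω) :
    HasDerivAt (fun s : ℝ => epsFF (A + s • a) x)
      (pairing epsUpper (fieldStrength A x) (fieldVariation A a x)
        + pairing epsUpper (fieldVariation A a x) (fieldStrength A x)) 0 := by
  have h : ∀ s : ℝ, fieldStrength (A + s • a) x = fun μ ν =>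
      fieldStrength A x μ ν + s • fieldVariation A a x μ ν + s ^ 2 • ⁅a x μ, a x ν⁆ := fun s => by
    funext μ ν; exact fieldStrength_add_smul hΩ hA ha hx s μ ν
  simp only [epsFF_eq_pairing, h, pairing_expand]
  exact hasDerivAt_quartic _ _ _ _ _

/-- The weight for which `pairing` gives the Yang–Mills density. -/
def ymWeight (μ ν α β : Fin 4) : ℝ :=
  if α = μ then if β = ν then 1 / 4 * (eta μ * eta ν) else 0 else 0

lemma pairing_ymWeight (P Q : Fin 4 → Fin 4 → Matrix (Fin n) (Fin n) ℂ) :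
    pairing ymWeight P Q = ∑ μ, ∑ ν, 1 / 4 * (eta μ * eta ν) * trForm (P μ ν) (Q μ ν) := by
  simp only [pairing, ymWeight]
  refine Finset.sum_congr rfl fun μ _ => Finset.sum_congr rfl fun ν _ => ?_
  rw [Finset.sum_eq_single μ (by intro α _ h; simp [h]) (by simp),
    Finset.sum_eq_single ν (by intro α _ h; simp [h]) (by simp)]
  simp

lemma ymDensity_eq_pairing (A : GaugeField n) (x : Spacetime) :
    ymDensity A x = pairing ymWeight (fieldStrength A x) (fieldStrength A x) := by
  simp only [pairing_ymWeight, ymDensity, fieldStrengthUpper, trForm_smul_right, Finset.mul_sum,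
    mul_assoc]

/-- The current `ε^{μναβ} tr (δA_ν F_{αβ})`. -/
def topCurrent (A a : GaugeField n) (x : Spacetime) (μ : Fin 4) : ℝ :=
  ∑ ν, ∑ α, ∑ β, epsUpper μ ν α β * trForm (a x ν) (fieldStrength A x α β)

/-- The boundary term `tr (F^{μν} δA_ν)` of the Yang–Mills functional. -/
def ymFlux (A a : GaugeField n) (x : Spacetime) (μ : Fin 4) : ℝ :=
  ∑ ν, eta μ * eta ν * trForm (fieldStrength A x μ ν) (a x ν)

lemma contDiffOn_topCurrent (hΩ : IsOpen Ω) (hA : ContDiffOn ℝ ∞ A Ω) (ha : ContDiffOn ℝ ∞ a Ω)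
    (μ : Fin 4) : ContDiffOn ℝ ∞ (fun y => topCurrent A a y μ) Ω :=
  ContDiffOn.sum fun ν _ => ContDiffOn.sum fun α _ => ContDiffOn.sum fun β _ =>
    contDiffOn_const.mul
      (contDiffOn_trForm (contDiffOn_component ha ν) (contDiffOn_fieldStrength hΩ hA α β))

lemma contDiffOn_ymFlux (hΩ : IsOpen Ω) (hA : ContDiffOn ℝ ∞ A Ω) (ha : ContDiffOn ℝ ∞ a Ω)
    (μ : Fin 4) : ContDiffOn ℝ ∞ (fun y => ymFlux A a y μ) Ω :=
  ContDiffOn.sum fun ν _ => contDiffOn_const.mul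
    (contDiffOn_trForm (contDiffOn_fieldStrength hΩ hA μ ν) (contDiffOn_component ha ν))

lemma sum_comm_pairs (f : Fin 4 → Fin 4 → Fin 4 → Fin 4 → ℝ) :
    ∑ μ, ∑ ν, ∑ α, ∑ β, f α β μ ν = ∑ μ, ∑ ν, ∑ α, ∑ β, f μ ν α β := by
  calc _ = ∑ μ, ∑ α, ∑ ν, ∑ β, f α β μ ν := Finset.sum_congr rfl fun _ _ => Finset.sum_comm
    _ = ∑ α, ∑ μ, ∑ ν, ∑ β, f α β μ ν := Finset.sum_comm
    _ = ∑ α, ∑ μ, ∑ β, ∑ ν, f α β μ ν := Finset.sum_congr rfl fun _ _ =>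
        Finset.sum_congr rfl fun _ _ => Finset.sum_comm
    _ = _ := Finset.sum_congr rfl fun _ _ => Finset.sum_comm

lemma pairing_epsUpper_comm (P Q : Fin 4 → Fin 4 → Matrix (Fin n) (Fin n) ℂ) :
    pairing epsUpper P Q = pairing epsUpper Q P := by
  rw [pairing, ← sum_comm_pairs, pairing]
  refine Finset.sum_congr rfl fun μ _ => Finset.sum_congr rfl fun ν _ =>
    Finset.sum_congr rfl fun α _ => Finset.sum_congr rfl fun β _ => ?_
  rw [epsUpper_pair μ ν α β, trForm_comm]

lemma pairing_epsUpper_antisymm (T Q : Fin 4 → Fin 4 → Matrix (Fin n) (Fin n) ℂ) :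
    pairing epsUpper (fun μ ν => T μ ν - T ν μ) Q = 2 * pairing epsUpper T Q := by
  have h1 : ∑ μ, ∑ ν, ∑ α, ∑ β, epsUpper μ ν α β * trForm (T ν μ) (Q α β)
      = -pairing epsUpper T Q := by
    rw [Finset.sum_comm]
    simp only [pairing, ← Finset.sum_neg_distrib]
    refine Finset.sum_congr rfl fun μ _ => Finset.sum_congr rfl fun ν _ =>
      Finset.sum_congr rfl fun α _ => Finset.sum_congr rfl fun β _ => ?_
    rw [epsUpper_swap₀₁ μ ν α β, neg_mul]
  have h2 : pairing epsUpper (fun μ ν => T μ ν - T ν μ) Q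
      = pairing epsUpper T Q - ∑ μ, ∑ ν, ∑ α, ∑ β, epsUpper μ ν α β * trForm (T ν μ) (Q α β) := by
    simp only [pairing, trForm_sub_left, mul_sub, Finset.sum_sub_distrib]
  rw [h2, h1]; ring

/-- The first variation of the constraint is a divergence. -/
lemma epsFF_variation (hΩ : IsOpen Ω) (hA : ContDiffOn ℝ ∞ A Ω) (ha : ContDiffOn ℝ ∞ a Ω)
    (hx : x ∈ Ω) :
    pairing epsUpper (fieldStrength A x) (fieldVariation A a x)
        + pairing epsUpper (fieldVariation A a x) (fieldStrength A x)
      = 4 * ∑ μ, partialD μ (fun y => topCurrent A a y μ) x := by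
  have hda := fun ν => differentiableAt_of_contDiffOn hΩ (contDiffOn_component ha ν) hx
  have hdF := fun α β =>
    differentiableAt_of_contDiffOn hΩ (contDiffOn_fieldStrength hΩ hA α β) hx
  have hdt := fun ν α β => differentiableAt_of_contDiffOn hΩ (contDiffOn_trForm
    (contDiffOn_component ha ν) (contDiffOn_fieldStrength hΩ hA α β)) hx
  have hdiv : ∀ μ, partialD μ (fun y => topCurrent A a y μ) x
      = ∑ ν, ∑ α, ∑ β, epsUpper μ ν α β *
        (trForm (partialD μ (fun y => a y ν) x) (fieldStrength A x α β)
          + trForm (a x ν) (partialD μ (fun y => fieldStrength A y α β) x)) := by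
    intro μ
    simp only [topCurrent]
    rw [partialD_sum _ _ fun ν _ => by fun_prop]
    refine Finset.sum_congr rfl fun ν _ => ?_
    rw [partialD_sum _ _ fun α _ => by fun_prop]
    refine Finset.sum_congr rfl fun α _ => ?_
    rw [partialD_sum _ _ fun β _ => by fun_prop]
    refine Finset.sum_congr rfl fun β _ => ?_
    rw [partialD_const_mul μ (hdt ν α β), partialD_trForm μ (hda ν) (hdF α β)]
  -- The Bianchi identity removes the terms of the divergence in which the derivative falls on `F`,
  -- once the derivative is made covariant.
  have hB : ∑ μ, ∑ ν, ∑ α, ∑ β, epsUpper μ ν α β * trForm (a x ν) (covD A μ α β x) = 0 := by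
    rw [Finset.sum_comm]
    refine Finset.sum_eq_zero fun ν _ => ?_
    have h := sum_epsUpper_smul_eq_zero (fun μ α β => covD A μ α β x)
      (fun μ α β => covD_cyclic hΩ hA hx μ α β) ν
    have h' := congrArg (trForm (a x ν)) h
    simpa only [trForm_sum_right, trForm_smul_right, trForm_zero_right] using h'
  have hG : fieldVariation A a x = fun μ ν =>
      (fun μ ν => partialD μ (fun y => a y ν) x + ⁅A x μ, a x ν⁆) μ ν
        - (fun μ ν => partialD μ (fun y => a y ν) x + ⁅A x μ, a x ν⁆) ν μ := by
    funext μ ν; exact fieldVariation_eq A a x μ ν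
  rw [pairing_epsUpper_comm (fieldStrength A x), hG, pairing_epsUpper_antisymm]
  simp only [hdiv]
  rw [← two_mul, ← mul_assoc, ← sub_eq_zero, show (2 : ℝ) * 2 = 4 by norm_num, ← mul_sub,
    mul_eq_zero_iff_left (by norm_num), ← neg_eq_zero, ← hB, neg_sub]
  simp only [pairing, ← Finset.sum_sub_distrib]
  refine Finset.sum_congr rfl fun μ _ => Finset.sum_congr rfl fun ν _ =>
    Finset.sum_congr rfl fun α _ => Finset.sum_congr rfl fun β _ => ?_
  -- By invariance of the trace form, the commutators with `A_μ` on the two factors cancel, so the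
  -- ordinary product rule is also the covariant one.
  rw [covD, trForm_add_left, trForm_add_right, trForm_lie (a x ν), ← lie_skew (a x ν) (A x μ),
    trForm_neg_left]
  ring

/-- The first variation of the Yang–Mills density. -/
lemma ymDensity_variation (hΩ : IsOpen Ω) (hA : ContDiffOn ℝ ∞ A Ω) (ha : ContDiffOn ℝ ∞ a Ω)
    (hx : x ∈ Ω) :
    pairing ymWeight (fieldStrength A x) (fieldVariation A a x)
        + pairing ymWeight (fieldVariation A a x) (fieldStrength A x)
      = ∑ μ, partialD μ (fun y => ymFlux A a y μ) x
        + ∑ ν, trForm (eta ν • current A x ν) (a x ν) := by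
  have hda := fun ν => differentiableAt_of_contDiffOn hΩ (contDiffOn_component ha ν) hx
  have hdF := fun α β =>
    differentiableAt_of_contDiffOn hΩ (contDiffOn_fieldStrength hΩ hA α β) hx
  have hdt := fun α β ν => differentiableAt_of_contDiffOn hΩ (contDiffOn_trForm
    (contDiffOn_fieldStrength hΩ hA α β) (contDiffOn_component ha ν)) hx
  have hdiv : ∀ μ, partialD μ (fun y => ymFlux A a y μ) x
      = ∑ ν, eta μ * eta ν *
        (trForm (partialD μ (fun y => fieldStrength A y μ ν) x) (a x ν)
          + trForm (fieldStrength A x μ ν) (partialD μ (fun y => a y ν) x)) := by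
    intro μ
    simp only [ymFlux]
    rw [partialD_sum _ _ fun ν _ => by fun_prop]
    refine Finset.sum_congr rfl fun ν _ => ?_
    rw [partialD_const_mul μ (hdt μ ν ν), partialD_trForm μ (hdF μ ν) (hda ν)]
  have hcov : ∀ μ ν, covD A μ ν μ x = -covD A μ μ ν x := by
    intro μ ν
    have h1 : (fun y => fieldStrength A y ν μ) = fun y => (-1 : ℝ) • fieldStrength A y μ ν := by
      funext y; rw [fieldStrength_antisymm A y μ ν]; simp
    rw [covD, h1, partialD_const_smul μ (hdF μ ν), fieldStrength_antisymm A x μ ν, lie_neg, covD]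
    simp [add_comm]
  -- `current` contracts the derivative with the second index of `F`, the divergence of `ymFlux`
  -- with the first; antisymmetry of `F` converts one into the other at the cost of a sign.
  have hcur : ∑ ν, trForm (eta ν • current A x ν) (a x ν)
      = ∑ μ, ∑ ν, -(eta μ * eta ν * trForm (covD A μ μ ν x) (a x ν)) := by
    rw [Finset.sum_comm]
    refine Finset.sum_congr rfl fun ν _ => ?_
    rw [current, trForm_smul_left, trForm_sum_left, Finset.mul_sum]
    refine Finset.sum_congr rfl fun μ _ => ?_
    rw [trForm_smul_left, hcov, trForm_neg_left]
    ring
  set T : Fin 4 → Fin 4 → Matrix (Fin n) (Fin n) ℂ :=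
    fun μ ν => partialD μ (fun y => a y ν) x + ⁅A x μ, a x ν⁆ with hT
  have hanti : ∑ μ, ∑ ν, eta μ * eta ν * trForm (fieldStrength A x μ ν) (T ν μ)
      = ∑ μ, ∑ ν, -(eta μ * eta ν * trForm (fieldStrength A x μ ν) (T μ ν)) := by
    rw [Finset.sum_comm]
    refine Finset.sum_congr rfl fun μ _ => Finset.sum_congr rfl fun ν _ => ?_
    rw [fieldStrength_antisymm A x μ ν, trForm_neg_left]
    ring
  have hG : ∀ μ ν, trForm (fieldStrength A x μ ν) (fieldVariation A a x μ ν)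
      = trForm (fieldStrength A x μ ν) (T μ ν) - trForm (fieldStrength A x μ ν) (T ν μ) := by
    intro μ ν
    rw [fieldVariation_eq, sub_eq_add_neg, trForm_add_right, trForm_neg_right, ← sub_eq_add_neg]
  have hL : pairing ymWeight (fieldStrength A x) (fieldVariation A a x)
        + pairing ymWeight (fieldVariation A a x) (fieldStrength A x)
      = 1 / 2 * (∑ μ, ∑ ν, eta μ * eta ν * trForm (fieldStrength A x μ ν) (T μ ν)
        - ∑ μ, ∑ ν, eta μ * eta ν * trForm (fieldStrength A x μ ν) (T ν μ)) := by
    simp only [pairing_ymWeight, Finset.mul_sum, ← Finset.sum_sub_distrib,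
      ← Finset.sum_add_distrib]
    refine Finset.sum_congr rfl fun μ _ => Finset.sum_congr rfl fun ν _ => ?_
    rw [trForm_comm (fieldVariation A a x μ ν), hG]
    ring
  rw [hL, hanti, hcur]
  simp only [hdiv, Finset.mul_sum, ← Finset.sum_sub_distrib, ← Finset.sum_add_distrib]
  refine Finset.sum_congr rfl fun μ _ => Finset.sum_congr rfl fun ν _ => ?_
  rw [hT, covD, trForm_add_left, trForm_add_right, trForm_lie (fieldStrength A x μ ν),
    ← lie_skew (fieldStrength A x μ ν) (A x μ), trForm_neg_left]
  ring

end YangMills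

end

/-! ### First variations of the functionals and the Euler–Lagrange equation. -/

noncomputable section

namespace YangMills

open MeasureTheory

variable {n : ℕ} {Ω : Set Spacetime} {A a : GaugeField n} {x : Spacetime}
  {𝔤 : LieSubalgebra ℝ (Matrix (Fin n) (Fin n) ℂ)} {K : Set Spacetime}

lemma integrableOn_of_contDiffOn (hK : IsCompact K) (hKΩ : K ⊆ Ω) {φ : Spacetime → ℝ}
    (hφ : ContDiffOn ℝ ∞ φ Ω) : IntegrableOn φ K :=
  (hφ.continuousOn.mono hKΩ).integrableOn_compact hK

lemma setIntegral_partialD_eq_zero (hΩ : IsOpen Ω) (hK : IsCompact K) (hKΩ : K ⊆ Ω)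
    {φ : Spacetime → ℝ} (hφ : ContDiffOn ℝ ∞ φ Ω) (hs : tsupport φ ⊆ K) (μ : Fin 4) :
    ∫ x in K, partialD μ φ x = 0 := by
  rw [setIntegral_eq_integral_of_forall_compl_eq_zero]
  · exact integral_partialD_eq_zero
      (contDiff_of_contDiffOn_of_tsupport hΩ hφ (hs.trans hKΩ))
      (hK.of_isClosed_subset (isClosed_tsupport _) hs) μ
  · intro x hx
    have h : fderiv ℝ φ x = 0 := (HasFDerivAt.of_notMem_tsupport ℝ fun h => hx (hs h)).fderiv
    rw [partialD, h]; rfl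

lemma setIntegral_sum_partialD_eq_zero (hΩ : IsOpen Ω) (hK : IsCompact K) (hKΩ : K ⊆ Ω)
    {φ : Spacetime → Fin 4 → ℝ} (hφ : ∀ μ, ContDiffOn ℝ ∞ (fun y => φ y μ) Ω)
    (hs : ∀ μ, tsupport (fun y => φ y μ) ⊆ K) :
    ∫ x in K, ∑ μ, partialD μ (fun y => φ y μ) x = 0 := by
  rw [integral_finsetSum]
  · exact Finset.sum_eq_zero fun μ _ => setIntegral_partialD_eq_zero hΩ hK hKΩ (hφ μ) (hs μ) μ
  · exact fun μ _ => ((contDiffOn_partialD hΩ (hφ μ) μ).continuousOn.mono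
      hKΩ).integrableOn_compact hK

/-- The tensor `ε^{μναβ} F_{αβ}`. -/
def dualF (A : GaugeField n) (x : Spacetime) (μ ν : Fin 4) : Matrix (Fin n) (Fin n) ℂ :=
  ∑ α, ∑ β, epsUpper μ ν α β • fieldStrength A x α β

/-- The contraction `ε^{μναβ} ξ_μ F_{αβ}`, transpose of `topCurrent`. -/
def dualCurrent (A : GaugeField n) (x : Spacetime) (ξ : Fin 4 → ℝ) (ν : Fin 4) :
    Matrix (Fin n) (Fin n) ℂ :=
  ∑ μ, ξ μ • dualF A x μ ν

lemma contDiffOn_dualF (hΩ : IsOpen Ω) (hA : ContDiffOn ℝ ∞ A Ω) (μ ν : Fin 4) :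
    ContDiffOn ℝ ∞ (fun y => dualF A y μ ν) Ω :=
  ContDiffOn.sum fun α _ => ContDiffOn.sum fun β _ =>
    ContDiffOn.const_smul _ (contDiffOn_fieldStrength hΩ hA α β)

lemma dualF_mem (hΩ : IsOpen Ω) (hA : ∀ y ∈ Ω, ∀ μ, A y μ ∈ 𝔤) (hx : x ∈ Ω) (μ ν : Fin 4) :
    dualF A x μ ν ∈ 𝔤 :=
  sum_mem fun α _ => sum_mem fun β _ => 𝔤.smul_mem _ (fieldStrength_mem 𝔤 hΩ hA hx α β)

lemma contDiffOn_dualCurrent (hΩ : IsOpen Ω) (hA : ContDiffOn ℝ ∞ A Ω)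
    {ξ : Spacetime → Fin 4 → ℝ} (hξ : ∀ μ, ContDiffOn ℝ ∞ (fun y => ξ y μ) Ω) (ν : Fin 4) :
    ContDiffOn ℝ ∞ (fun y => dualCurrent A y (ξ y) ν) Ω :=
  ContDiffOn.sum fun μ _ => ContDiffOn.smul (hξ μ) (contDiffOn_dualF hΩ hA μ ν)

lemma dualCurrent_mem (hΩ : IsOpen Ω) (hA : ∀ y ∈ Ω, ∀ μ, A y μ ∈ 𝔤) (hx : x ∈ Ω)
    (ξ : Fin 4 → ℝ) (ν : Fin 4) : dualCurrent A x ξ ν ∈ 𝔤 :=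
  sum_mem fun μ _ => 𝔤.smul_mem _ (dualF_mem hΩ hA hx μ ν)

lemma topCurrent_eq (A a : GaugeField n) (x : Spacetime) (μ : Fin 4) :
    topCurrent A a x μ = ∑ ν, trForm (a x ν) (dualF A x μ ν) := by
  simp only [topCurrent, dualF, trForm_sum_right, trForm_smul_right]

/-- This duality turns trace pairings on matrix-valued covectors into pairings of a one-form with a
vector field. -/
lemma sum_trForm_dualCurrent (A a : GaugeField n) (x : Spacetime) (ξ : Fin 4 → ℝ) :
    ∑ ν, trForm (dualCurrent A x ξ ν) (a x ν) = ∑ μ, ξ μ * topCurrent A a x μ := by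
  simp only [dualCurrent, topCurrent_eq, trForm_sum_left, trForm_smul_left, Finset.mul_sum]
  rw [Finset.sum_comm]
  simp only [trForm_comm]

lemma tsupport_topCurrent_subset (A a : GaugeField n) (μ : Fin 4) :
    tsupport (fun y => topCurrent A a y μ) ⊆ tsupport a := by
  refine closure_mono fun y hy h => hy ?_
  simp [topCurrent, h, trForm_zero_left]

lemma tsupport_ymFlux_subset (A a : GaugeField n) (μ : Fin 4) :
    tsupport (fun y => ymFlux A a y μ) ⊆ tsupport a := by
  refine closure_mono fun y hy h => hy ?_
  simp [ymFlux, h, trForm_zero_right]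

lemma contDiffOn_sum_trForm {P Q : GaugeField n} (hP : ∀ ν, ContDiffOn ℝ ∞ (fun y => P y ν) Ω)
    (hQ : ∀ ν, ContDiffOn ℝ ∞ (fun y => Q y ν) Ω) :
    ContDiffOn ℝ ∞ (fun y => ∑ ν, trForm (P y ν) (Q y ν)) Ω :=
  ContDiffOn.sum fun ν _ => contDiffOn_trForm (hP ν) (hQ ν)

lemma contDiffOn_eta_smul_current (hΩ : IsOpen Ω) (hA : ContDiffOn ℝ ∞ A Ω) (ν : Fin 4) :
    ContDiffOn ℝ ∞ (fun y => eta ν • current A y ν) Ω :=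
  ContDiffOn.const_smul _ (contDiffOn_current hΩ hA ν)

/-- The first variation of the Yang–Mills functional. -/
lemma hasDerivAt_action (hΩ : IsOpen Ω) (hA : ContDiffOn ℝ ∞ A Ω) (ha : IsVariation 𝔤 Ω K a) :
    HasDerivAt (fun s : ℝ => action K (A + s • a))
      (∫ x in K, ∑ ν, trForm (eta ν • current A x ν) (a x ν)) 0 := by
  have has : ContDiffOn ℝ ∞ a Ω := ha.smooth.contDiffOn
  have h := hasDerivAt_integral_pairing hΩ hA has ha.compact ha.subset
    (g := fun _ => 1) continuousOn_const ymWeight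
  simp only [one_mul, ← ymDensity_eq_pairing] at h
  refine HasDerivAt.congr_deriv h ?_
  rw [setIntegral_congr_fun ha.compact.measurableSet
    fun x hx => ymDensity_variation hΩ hA has (ha.subset hx), integral_add,
    setIntegral_sum_partialD_eq_zero hΩ ha.compact ha.subset (contDiffOn_ymFlux hΩ hA has)
      (fun μ => (tsupport_ymFlux_subset A a μ).trans ha.support), zero_add]
  · exact integrableOn_of_contDiffOn ha.compact ha.subset (ContDiffOn.sum fun μ _ =>
      contDiffOn_partialD hΩ (contDiffOn_ymFlux hΩ hA has μ) μ)
  · exact integrableOn_of_contDiffOn ha.compact ha.subset (contDiffOn_sum_trForm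
      (contDiffOn_eta_smul_current hΩ hA) (contDiffOn_component has))

/-- The first variation of `H̃(f)`. -/
lemma hasDerivAt_helicity (hΩ : IsOpen Ω) (hA : ContDiffOn ℝ ∞ A Ω) (ha : IsVariation 𝔤 Ω K a)
    {f : Spacetime → ℝ} (hf : ContDiffOn ℝ ∞ f Ω) :
    HasDerivAt (fun s : ℝ => helicity K f (A + s • a))
      (-∫ x in K, ∑ ν, trForm (dualCurrent A x (fun μ => partialD μ f x) ν) (a x ν)) 0 := by
  have has : ContDiffOn ℝ ∞ a Ω := ha.smooth.contDiffOn
  have hJ := contDiffOn_topCurrent hΩ hA has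
  have hfJ := fun μ => hf.mul (hJ μ)
  have h := hasDerivAt_integral_pairing hΩ hA has ha.compact ha.subset
    (g := fun x => 1 / 4 * f x) (continuousOn_const.mul (hf.continuousOn.mono ha.subset)) epsUpper
  -- The factor `1/4` cancels the `4` of `epsFF_variation`; what remains is `f ∂_μ J^μ = ∂_μ (f J^μ)
  -- - ∂_μ f J^μ`.
  have hpt : ∀ x ∈ K, 1 / 4 * f x * (pairing epsUpper (fieldStrength A x) (fieldVariation A a x)
        + pairing epsUpper (fieldVariation A a x) (fieldStrength A x))
      = ∑ μ, partialD μ (fun y => f y * topCurrent A a y μ) x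
        - ∑ ν, trForm (dualCurrent A x (fun μ => partialD μ f x) ν) (a x ν) := by
    intro x hx
    rw [epsFF_variation hΩ hA has (ha.subset hx), sum_trForm_dualCurrent, Finset.mul_sum,
      Finset.mul_sum, ← Finset.sum_sub_distrib]
    refine Finset.sum_congr rfl fun μ _ => ?_
    rw [partialD_mul μ (differentiableAt_of_contDiffOn hΩ hf (ha.subset hx))
      (differentiableAt_of_contDiffOn hΩ (hJ μ) (ha.subset hx))]
    ring
  simp only [← epsFF_eq_pairing] at h
  refine HasDerivAt.congr_deriv h ?_
  rw [setIntegral_congr_fun ha.compact.measurableSet hpt, integral_sub,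
    setIntegral_sum_partialD_eq_zero hΩ ha.compact ha.subset hfJ, zero_sub]
  · intro μ
    exact (tsupport_mul_subset_right (f := f)).trans
      ((tsupport_topCurrent_subset A a μ).trans ha.support)
  · exact integrableOn_of_contDiffOn ha.compact ha.subset (ContDiffOn.sum fun μ _ =>
      contDiffOn_partialD hΩ (hfJ μ) μ)
  · exact integrableOn_of_contDiffOn ha.compact ha.subset (contDiffOn_sum_trForm
      (contDiffOn_dualCurrent hΩ hA fun μ => contDiffOn_partialD hΩ hf μ)
      (contDiffOn_component has))

/-- The Euler–Lagrange expression of `W - ½ H̃(f)`. -/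
def eulerLagrange (f : Spacetime → ℝ) (A : GaugeField n) : GaugeField n := fun x ν =>
  eta ν • current A x ν + (1 / 2 : ℝ) • dualCurrent A x (fun μ => partialD μ f x) ν

lemma contDiffOn_eulerLagrange (hΩ : IsOpen Ω) (hA : ContDiffOn ℝ ∞ A Ω) {f : Spacetime → ℝ}
    (hf : ContDiffOn ℝ ∞ f Ω) (ν : Fin 4) :
    ContDiffOn ℝ ∞ (fun y => eulerLagrange f A y ν) Ω :=
  ContDiffOn.add (contDiffOn_eta_smul_current hΩ hA ν) (ContDiffOn.const_smul _
    (contDiffOn_dualCurrent hΩ hA (fun μ => contDiffOn_partialD hΩ hf μ) ν))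

lemma eulerLagrange_mem (hΩ : IsOpen Ω) (hA : ∀ y ∈ Ω, ∀ μ, A y μ ∈ 𝔤) (hx : x ∈ Ω)
    (f : Spacetime → ℝ) (ν : Fin 4) : eulerLagrange f A x ν ∈ 𝔤 :=
  add_mem (𝔤.smul_mem _ (current_mem 𝔤 hΩ hA hx ν)) (𝔤.smul_mem _ (dualCurrent_mem hΩ hA hx _ ν))

lemma hasDerivAt_multiplier (hΩ : IsOpen Ω) (hA : ContDiffOn ℝ ∞ A Ω) (ha : IsVariation 𝔤 Ω K a)
    {f : Spacetime → ℝ} (hf : ContDiffOn ℝ ∞ f Ω) :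
    HasDerivAt (fun s : ℝ => action K (A + s • a) - 1 / 2 * helicity K f (A + s • a))
      (∫ x in K, ∑ ν, trForm (eulerLagrange f A x ν) (a x ν)) 0 := by
  refine ((hasDerivAt_action hΩ hA ha).fun_sub
    ((hasDerivAt_helicity hΩ hA ha hf).const_mul (1 / 2))).congr_deriv ?_
  have has : ContDiffOn ℝ ∞ a Ω := ha.smooth.contDiffOn
  rw [mul_neg, sub_neg_eq_add, ← integral_const_mul, ← integral_add]
  · simp only [eulerLagrange, trForm_add_left, Finset.sum_add_distrib, trForm_smul_left,
      Finset.mul_sum]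
  · exact integrableOn_of_contDiffOn ha.compact ha.subset (contDiffOn_sum_trForm
      (contDiffOn_eta_smul_current hΩ hA) (contDiffOn_component has))
  · exact Integrable.const_mul (integrableOn_of_contDiffOn ha.compact ha.subset
      (contDiffOn_sum_trForm
      (contDiffOn_dualCurrent hΩ hA fun μ => contDiffOn_partialD hΩ hf μ)
      (contDiffOn_component has))) _

/-- The two equations differ by the nonzero factor `eta ν`. The sign of the `½` term arises because
`λ` is contracted with the second index of `ε` in one and with the first in the other. -/
lemma isBeltrami_iff (f : Spacetime → ℝ) (A : GaugeField n) :
    IsBeltrami Ω f A ↔ ∀ x ∈ Ω, ∀ ν, eulerLagrange f A x ν = 0 := by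
  refine forall₂_congr fun x _ => forall_congr' fun ν => ?_
  have h : ∑ μ, ∑ α, ∑ β, (epsLower ν μ α β * (eta μ * partialD μ f x)) •
      fieldStrengthUpper A x α β = -(eta ν • dualCurrent A x (fun μ => partialD μ f x) ν) := by
    simp only [dualCurrent, dualF, fieldStrengthUpper, Finset.smul_sum, smul_smul,
      ← Finset.sum_neg_distrib, ← neg_smul]
    refine Finset.sum_congr rfl fun μ _ => Finset.sum_congr rfl fun α _ =>
      Finset.sum_congr rfl fun β _ => ?_
    congr 1
    rw [epsUpper, epsLower_swap₀₁ ν μ α β]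
    linear_combination (-(eta μ * eta α * eta β * partialD μ f x * epsLower ν μ α β))
      * eta_mul_self ν
  rw [h, ← current, eulerLagrange, smul_neg, eq_neg_iff_add_eq_zero]
  rw [← smul_right_injective _ (eta_ne_zero ν) |>.eq_iff, smul_zero, smul_add, smul_comm (eta ν),
    smul_smul (eta ν) (eta ν), eta_mul_self, one_smul]

/-- The cutoff makes a field controlled only on `Ω` into a global variation, zero outside `Ω`. -/
lemma isVariation_smul {χ : Spacetime → ℝ} (hΩ : IsOpen Ω) (hχ : ContDiff ℝ ∞ χ)
    (hχc : HasCompactSupport χ) (hχΩ : tsupport χ ⊆ Ω) {Y : GaugeField n}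
    (hY : ∀ ν, ContDiffOn ℝ ∞ (fun y => Y y ν) Ω) (hm : ∀ y ∈ Ω, ∀ ν, Y y ν ∈ 𝔤) :
    IsVariation 𝔤 Ω (tsupport χ) (fun y ν => χ y • Y y ν) := by
  have hs : tsupport (fun y ν => χ y • Y y ν) ⊆ tsupport χ := by
    refine closure_mono fun y hy h => hy ?_
    funext ν; simp [h]
  refine ⟨contDiff_of_contDiffOn_of_tsupport hΩ ?_ (hs.trans hχΩ), fun y ν => ?_, hχc, hχΩ, hs⟩
  · exact contDiffOn_pi.2 fun ν => ContDiffOn.smul hχ.contDiffOn (hY ν)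
  · by_cases hy : y ∈ Ω
    · exact 𝔤.smul_mem _ (hm y hy ν)
    · have : χ y = 0 := image_eq_zero_of_notMem_tsupport fun h => hy (hχΩ h)
      simp only [this, zero_smul]
      exact 𝔤.zero_mem

/-- The fundamental lemma of the calculus of variations, for variations along a fixed field. -/
lemma eq_zero_of_integral_bump (h𝔤 : ∀ X ∈ 𝔤, Xᴴ = -X) (hΩ : IsOpen Ω) {Y : GaugeField n}
    (hY : ∀ ν, ContDiffOn ℝ ∞ (fun y => Y y ν) Ω) (hm : ∀ y ∈ Ω, ∀ ν, Y y ν ∈ 𝔤)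
    (H : ∀ χ : Spacetime → ℝ, ContDiff ℝ ∞ χ → HasCompactSupport χ → tsupport χ ⊆ Ω →
      ∫ y in tsupport χ, χ y * ∑ ν, trForm (Y y ν) (Y y ν) = 0) (hx : x ∈ Ω) (ν : Fin 4) :
    Y x ν = 0 := by
  obtain ⟨χ, hχΩ, hχc, hχ, hχr, hχx⟩ := exists_contDiff_tsupport_subset (n := ⊤) (hΩ.mem_nhds hx)
  have hq : ContDiffOn ℝ ∞ (fun y => ∑ ν, trForm (Y y ν) (Y y ν)) Ω := contDiffOn_sum_trForm hY hY
  set q : Spacetime → ℝ := fun y => ∑ ν, trForm (Y y ν) (Y y ν) with hqdef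
  have hq0 : ∀ y ∈ Ω, q y ≤ 0 := fun y hy =>
    Finset.sum_nonpos fun ν _ => trForm_self_nonpos (h𝔤 _ (hm y hy ν))
  have hsub : tsupport (fun y => -(χ y * q y)) ⊆ tsupport χ := by
    refine closure_mono fun y hy h => hy ?_
    simp [h]
  have hcont : Continuous fun y => -(χ y * q y) :=
    (contDiff_of_contDiffOn_of_tsupport hΩ ((hχ.contDiffOn.mul hq).neg)
      (hsub.trans hχΩ)).continuous
  have hzero : ∫ y, -(χ y * q y) = 0 := by
    rw [integral_neg, neg_eq_zero, ← H χ hχ hχc hχΩ]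
    refine (setIntegral_eq_integral_of_forall_compl_eq_zero fun y hy => ?_).symm
    rw [image_eq_zero_of_notMem_tsupport hy, zero_mul]
  -- `-(χ q)` is continuous, nonnegative and compactly supported; being positive at `x` would give
  -- it a positive integral.
  have hqx : q x = 0 := by
    by_contra hne
    refine (hcont.integral_pos_of_hasCompactSupport_nonneg_nonzero (μ := volume) (x := x)
      (hχc.of_isClosed_subset (isClosed_tsupport _) hsub) (fun y => ?_) ?_).ne' hzero
    · by_cases hy : y ∈ Ω
      · have h1 : 0 ≤ χ y := (hχr ⟨y, rfl⟩).1
        simpa using mul_nonpos_of_nonneg_of_nonpos h1 (hq0 y hy)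
      · have : χ y = 0 := image_eq_zero_of_notMem_tsupport fun h => hy (hχΩ h)
        simp [this]
    · simpa [hχx] using hne
  have h1 := (Finset.sum_eq_zero_iff_of_nonpos fun ν _ =>
    trForm_self_nonpos (h𝔤 _ (hm x hx ν))).1 hqx ν (Finset.mem_univ ν)
  exact eq_zero_of_trForm_self (h𝔤 _ (hm x hx ν)) h1

lemma sum_trForm_smul_right (P Y : GaugeField n) (χ : Spacetime → ℝ) (y : Spacetime) :
    ∑ ν, trForm (P y ν) (χ y • Y y ν) = χ y * ∑ ν, trForm (P y ν) (Y y ν) := by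
  simp only [trForm_smul_right, Finset.mul_sum]

/-- Extremals of `W - ½ H̃(f)` are the solutions of the Beltrami equation. -/
theorem isMultiplierExtremal_iff_isBeltrami (h𝔤 : ∀ X ∈ 𝔤, Xᴴ = -X) (hΩ : IsOpen Ω)
    (hA : IsPotential 𝔤 Ω A) {f : Spacetime → ℝ} (hf : ContDiffOn ℝ ∞ f Ω) :
    IsMultiplierExtremal 𝔤 Ω f A ↔ IsBeltrami Ω f A := by
  rw [isBeltrami_iff]
  constructor
  · intro h x hx ν
    have hE := contDiffOn_eulerLagrange hΩ hA.smooth hf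
    have hm : ∀ y ∈ Ω, ∀ ν, eulerLagrange f A y ν ∈ 𝔤 := fun y hy ν =>
      eulerLagrange_mem hΩ hA.mem hy f ν
    -- The test variation is `χ` times the Euler–Lagrange expression itself, which is allowed
    -- because that expression is `𝔤`-valued.
    refine eq_zero_of_integral_bump h𝔤 hΩ hE hm (fun χ hχ hχc hχΩ => ?_) hx ν
    have hv := isVariation_smul hΩ hχ hχc hχΩ hE hm
    have := (hasDerivAt_multiplier hΩ hA.smooth hv hf).unique (h _ _ hv)
    simpa only [sum_trForm_smul_right] using this
  · intro h K a ha
    have hd := hasDerivAt_multiplier hΩ hA.smooth ha hf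
    rwa [setIntegral_eq_zero_of_forall_eq_zero fun x hx => by
      simp only [h x (ha.subset hx), trForm_zero_left, Finset.sum_const_zero]] at hd

end YangMills

end

/-! ### Constrained extremals and the construction of the multiplier. -/

noncomputable section

namespace YangMills

open MeasureTheory

variable {n : ℕ} {Ω : Set Spacetime} {A a : GaugeField n} {x : Spacetime}
  {𝔤 : LieSubalgebra ℝ (Matrix (Fin n) (Fin n) ℂ)} {K : Set Spacetime}

lemma contDiffOn_det {m : ℕ} {M : Spacetime → Matrix (Fin m) (Fin m) ℝ}
    (hM : ∀ i j, ContDiffOn ℝ ∞ (fun y => M y i j) Ω) :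
    ContDiffOn ℝ ∞ (fun y => (M y).det) Ω := by
  simp only [Matrix.det_apply']
  exact ContDiffOn.sum fun σ _ => contDiffOn_const.mul (contDiffOn_prod fun i _ => hM _ _)

/-- By Cramer's rule the entries of the inverse are quotients of determinants. -/
lemma contDiffOn_inv_apply {m : ℕ} {M : Spacetime → Matrix (Fin m) (Fin m) ℝ}
    (hM : ∀ i j, ContDiffOn ℝ ∞ (fun y => M y i j) Ω) (hdet : ∀ y ∈ Ω, (M y).det ≠ 0)
    (i j : Fin m) : ContDiffOn ℝ ∞ (fun y => (M y)⁻¹ i j) Ω := by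
  simp only [Matrix.inv_def, Matrix.smul_apply, smul_eq_mul, Ring.inverse_eq_inv',
    Matrix.adjugate_apply]
  refine ((contDiffOn_det hM).inv hdet).mul (contDiffOn_det fun k l => ?_)
  by_cases h : k = j
  · subst h
    simp only [Matrix.updateRow_self]
    exact contDiffOn_const
  · simp only [Matrix.updateRow_ne h]
    exact hM k l

lemma contDiffOn_mulVec {m : ℕ} {M : Spacetime → Matrix (Fin m) (Fin m) ℝ}
    (hM : ∀ i j, ContDiffOn ℝ ∞ (fun y => M y i j) Ω) {u : Spacetime → Fin m → ℝ}
    (hu : ∀ i, ContDiffOn ℝ ∞ (fun y => u y i) Ω) (i : Fin m) :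
    ContDiffOn ℝ ∞ (fun y => (M y *ᵥ u y) i) Ω := by
  simp only [Matrix.mulVec, dotProduct]
  exact ContDiffOn.sum fun j _ => (hM i j).mul (hu j)

/-- The Gram matrix of the linearized constraint's principal symbol. -/
def symbolGram (A : GaugeField n) (x : Spacetime) : Matrix (Fin 4) (Fin 4) ℝ :=
  Matrix.of fun μ σ => ∑ ν, trForm (dualF A x σ ν) (dualF A x μ ν)

/-- The symbol composed with its transpose is the Gram matrix; inverting the latter gives a right
inverse of the symbol. -/
lemma topCurrent_of_apply_eq_dualCurrent {ξ : Fin 4 → ℝ}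
    (ha : ∀ ν, a x ν = dualCurrent A x ξ ν) (μ : Fin 4) :
    topCurrent A a x μ = (symbolGram A x *ᵥ ξ) μ := by
  simp only [topCurrent_eq, ha, dualCurrent, trForm_sum_left, trForm_smul_left, Matrix.mulVec,
    dotProduct, symbolGram, Matrix.of_apply, Finset.sum_mul]
  rw [Finset.sum_comm]
  simp only [mul_comm]

lemma contDiffOn_symbolGram (hΩ : IsOpen Ω) (hA : ContDiffOn ℝ ∞ A Ω) (μ σ : Fin 4) :
    ContDiffOn ℝ ∞ (fun y => symbolGram A y μ σ) Ω := by
  simp only [symbolGram, Matrix.of_apply]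
  exact ContDiffOn.sum fun ν _ => contDiffOn_trForm (contDiffOn_dualF hΩ hA σ ν)
    (contDiffOn_dualF hΩ hA μ ν)

/-- At a regular point, the principal symbol of the linearized constraint is surjective. -/
lemma det_symbolGram_ne_zero (h𝔤 : ∀ X ∈ 𝔤, Xᴴ = -X) (hΩ : IsOpen Ω) (hA : IsPotential 𝔤 Ω A)
    (hreg : IsRegular Ω A) (hx : x ∈ Ω) : (symbolGram A x).det ≠ 0 := by
  intro hdet
  obtain ⟨ξ, hξ, hM⟩ := Matrix.exists_mulVec_eq_zero_iff.2 hdet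
  have hanti : ∀ ν, (dualCurrent A x ξ ν)ᴴ = -dualCurrent A x ξ ν := fun ν =>
    h𝔤 _ (dualCurrent_mem hΩ hA.mem hx ξ ν)
  -- This sum is the quadratic form of the Gram matrix at a kernel vector `ξ`. Definiteness forces
  -- `dualCurrent A x ξ = 0`, contrary to regularity.
  have hsum : ∑ ν, trForm (dualCurrent A x ξ ν) (dualCurrent A x ξ ν) = 0 := by
    rw [sum_trForm_dualCurrent A (fun y ν => dualCurrent A y ξ ν)]
    refine Finset.sum_eq_zero fun μ _ => ?_
    rw [topCurrent_of_apply_eq_dualCurrent (a := fun y ν => dualCurrent A y ξ ν) (ξ := ξ)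
      (fun ν => rfl), hM, Pi.zero_apply, mul_zero]
  have hzero : ∀ ν, dualCurrent A x ξ ν = 0 := fun ν =>
    eq_zero_of_trForm_self (hanti ν) ((Finset.sum_eq_zero_iff_of_nonpos fun ν _ =>
      trForm_self_nonpos (hanti ν)).1 hsum ν (Finset.mem_univ ν))
  obtain ⟨μ, hμ⟩ := hreg x hx ξ hξ
  apply hμ
  have h : ∑ ν, ∑ α, ∑ β, (epsUpper μ ν α β * ξ ν) • fieldStrength A x α β
      = -dualCurrent A x ξ μ := by
    simp only [dualCurrent, dualF, Finset.smul_sum, smul_smul, ← Finset.sum_neg_distrib, ← neg_smul]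
    refine Finset.sum_congr rfl fun ν _ => Finset.sum_congr rfl fun α _ =>
      Finset.sum_congr rfl fun β _ => ?_
    rw [epsUpper_swap₀₁ μ ν α β, mul_neg, neg_neg, mul_comm]
  rw [h, hzero, neg_zero]

/-- A constrained extremal is stationary under variations with divergence-free `topCurrent`. -/
lemma IsConstrainedExtremal.integral_eq_zero (hΩ : IsOpen Ω) (hA : IsPotential 𝔤 Ω A)
    (hext : IsConstrainedExtremal 𝔤 Ω A) (ha : IsVariation 𝔤 Ω K a)
    (hdiv : ∀ x ∈ Ω, ∑ μ, partialD μ (fun y => topCurrent A a y μ) x = 0) :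
    ∫ x in K, ∑ ν, trForm (eta ν • current A x ν) (a x ν) = 0 := by
  refine (hasDerivAt_action hΩ hA.smooth ha).unique (hext.stationary K a ha fun x hx => ?_)
  have h := hasDerivAt_epsFF hΩ hA.smooth ha.smooth.contDiffOn hx
  rwa [epsFF_variation hΩ hA.smooth ha.smooth.contDiffOn hx, hdiv x hx, mul_zero] at h

lemma partialD_congr_of_eqOn {V : Type*} [NormedAddCommGroup V] [NormedSpace ℝ V] (hΩ : IsOpen Ω)
    {φ ψ : Spacetime → V} (h : Set.EqOn φ ψ Ω) (hx : x ∈ Ω) (μ : Fin 4) :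
    partialD μ φ x = partialD μ ψ x := by
  rw [partialD, (h.eventuallyEq_of_mem (hΩ.mem_nhds hx)).fderiv_eq, partialD]

/-- The pointwise Lagrange multiplier: the coefficient of the Yang–Mills current along the range of
the transposed symbol. -/
def multiplier (A : GaugeField n) (x : Spacetime) : Fin 4 → ℝ :=
  (symbolGram A x)⁻¹ *ᵥ topCurrent A (fun y ν => eta ν • current A y ν) x

lemma contDiffOn_multiplier (h𝔤 : ∀ X ∈ 𝔤, Xᴴ = -X) (hΩ : IsOpen Ω) (hA : IsPotential 𝔤 Ω A)
    (hreg : IsRegular Ω A) (μ : Fin 4) : ContDiffOn ℝ ∞ (fun y => multiplier A y μ) Ω :=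
  contDiffOn_mulVec
    (contDiffOn_inv_apply (contDiffOn_symbolGram hΩ hA.smooth) fun _ hy =>
      det_symbolGram_ne_zero h𝔤 hΩ hA hreg hy)
    (contDiffOn_topCurrent hΩ hA.smooth (contDiffOn_pi.2
      (contDiffOn_eta_smul_current hΩ hA.smooth)))
    μ

lemma topCurrent_sub (A a b : GaugeField n) (x : Spacetime) (μ : Fin 4) :
    topCurrent A (fun y ν => a y ν - b y ν) x μ = topCurrent A a x μ - topCurrent A b x μ := by
  simp only [topCurrent_eq, trForm_sub_left, Finset.sum_sub_distrib]

lemma topCurrent_smul (A a : GaugeField n) (χ : Spacetime → ℝ) (x : Spacetime) (μ : Fin 4) :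
    topCurrent A (fun y ν => χ y • a y ν) x μ = χ x * topCurrent A a x μ := by
  simp only [topCurrent_eq, trForm_smul_left, Finset.mul_sum]

/-- At a constrained extremal, the Yang–Mills current is in the range of the transposed symbol. -/
lemma IsConstrainedExtremal.current_eq (h𝔤 : ∀ X ∈ 𝔤, Xᴴ = -X) (hΩ : IsOpen Ω)
    (hA : IsPotential 𝔤 Ω A) (hreg : IsRegular Ω A) (hext : IsConstrainedExtremal 𝔤 Ω A)
    (hx : x ∈ Ω) (ν : Fin 4) :
    eta ν • current A x ν = dualCurrent A x (multiplier A x) ν := by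
  set E : GaugeField n := fun y ν => eta ν • current A y ν with hE
  set D : GaugeField n := fun y ν => dualCurrent A y (multiplier A y) ν with hD
  -- `D` is the orthogonal projection of `E` onto the range of the transposed symbol, so `r` lies in
  -- the kernel of the symbol.
  set r : GaugeField n := fun y ν => E y ν - D y ν with hr
  have hrs : ∀ ν, ContDiffOn ℝ ∞ (fun y => r y ν) Ω := fun ν =>
    ContDiffOn.sub (contDiffOn_eta_smul_current hΩ hA.smooth ν)
      (contDiffOn_dualCurrent hΩ hA.smooth (contDiffOn_multiplier h𝔤 hΩ hA hreg) ν)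
  have hrm : ∀ y ∈ Ω, ∀ ν, r y ν ∈ 𝔤 := fun y hy ν =>
    sub_mem (𝔤.smul_mem _ (current_mem 𝔤 hΩ hA.mem hy ν)) (dualCurrent_mem hΩ hA.mem hy _ ν)
  have hrJ : ∀ y ∈ Ω, ∀ μ, topCurrent A r y μ = 0 := by
    intro y hy μ
    have hu : IsUnit (symbolGram A y).det :=
      (det_symbolGram_ne_zero h𝔤 hΩ hA hreg hy).isUnit
    rw [hr, topCurrent_sub, topCurrent_of_apply_eq_dualCurrent (a := D) (fun ν => rfl), multiplier,
      Matrix.mulVec_mulVec, Matrix.mul_nonsing_inv _ hu, Matrix.one_mulVec, sub_self]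
  have hEr : ∀ y ∈ Ω, ∑ ν, trForm (E y ν) (r y ν) = ∑ ν, trForm (r y ν) (r y ν) := by
    intro y hy
    have h1 : ∑ ν, trForm (D y ν) (r y ν) = 0 := by
      rw [sum_trForm_dualCurrent A r]
      exact Finset.sum_eq_zero fun μ _ => by rw [hrJ y hy, mul_zero]
    have h2 : ∀ ν, E y ν = r y ν + D y ν := fun ν => by simp [hr]
    calc ∑ ν, trForm (E y ν) (r y ν) = ∑ ν, trForm (r y ν) (r y ν)
          + ∑ ν, trForm (D y ν) (r y ν) := by
          rw [← Finset.sum_add_distrib]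
          exact Finset.sum_congr rfl fun ν _ => by rw [← trForm_add_left, ← h2]
      _ = _ := by rw [h1, add_zero]
  refine sub_eq_zero.1 (eq_zero_of_integral_bump h𝔤 hΩ hrs hrm (fun χ hχ hχc hχΩ => ?_) hx ν)
  -- `topCurrent` involves no derivative of the variation, so `χ r` also has zero current and is
  -- admissible. Since `r` is orthogonal to `D`, stationarity reads `∫ χ tr (r r) = 0`.
  have hv := isVariation_smul hΩ hχ hχc hχΩ hrs hrm
  have h0 := hext.integral_eq_zero hΩ hA hv fun y hy => Finset.sum_eq_zero fun μ _ => by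
    rw [partialD_congr_of_eqOn (ψ := fun _ => (0 : ℝ)) hΩ (fun z hz => ?_) hy μ]
    · simp [partialD]
    · simp only [topCurrent_smul, hrJ z hz, mul_zero]
  rw [← h0]
  refine setIntegral_congr_fun hχc.measurableSet fun y hy => ?_
  exact (sum_trForm_smul_right E r χ y).trans (by rw [hEr y (hχΩ hy)]) |>.symm

/-- The multiplier of a constrained extremal annihilates the divergence-free fields. -/
lemma IsConstrainedExtremal.integral_multiplier (h𝔤 : ∀ X ∈ 𝔤, Xᴴ = -X) (hΩ : IsOpen Ω)
    (hA : IsPotential 𝔤 Ω A) (hreg : IsRegular Ω A) (hext : IsConstrainedExtremal 𝔤 Ω A)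
    {v : Spacetime → Fin 4 → ℝ} (hv : ContDiff ℝ ∞ v) (hvc : HasCompactSupport v)
    (hvΩ : tsupport v ⊆ Ω) (hdiv : ∀ x, divergence v x = 0) :
    ∫ x, ∑ μ, multiplier A x μ * v x μ = 0 := by
  have hv0 : ∀ y, y ∉ tsupport v → v y = 0 := fun y hy => image_eq_zero_of_notMem_tsupport hy
  -- The right inverse of the symbol applied to `v`: the current of `b` is `v`, so `b` is admissible
  -- because `v` is divergence-free.
  set b : GaugeField n := fun y ν => dualCurrent A y ((symbolGram A y)⁻¹ *ᵥ v y) ν with hb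
  have hb0 : ∀ y, v y = 0 → b y = 0 := fun y hy => by
    funext ν; simp [hb, hy, dualCurrent]
  have hbs : tsupport b ⊆ tsupport v := closure_mono fun y hy h => hy (hb0 y h)
  have hvar : IsVariation 𝔤 Ω (tsupport v) b := by
    refine ⟨contDiff_of_contDiffOn_of_tsupport hΩ ?_ (hbs.trans hvΩ), fun y ν => ?_, hvc, hvΩ, hbs⟩
    · exact contDiffOn_pi.2 (contDiffOn_dualCurrent hΩ hA.smooth (contDiffOn_mulVec
        (contDiffOn_inv_apply (contDiffOn_symbolGram hΩ hA.smooth) fun _ hy =>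
          det_symbolGram_ne_zero h𝔤 hΩ hA hreg hy) (contDiffOn_pi.1 hv.contDiffOn)))
    · by_cases hy : y ∈ Ω
      · exact dualCurrent_mem hΩ hA.mem hy _ ν
      · rw [hb0 y (hv0 y fun h => hy (hvΩ h))]
        exact 𝔤.zero_mem
  have hbJ : ∀ y ∈ Ω, ∀ μ, topCurrent A b y μ = v y μ := by
    intro y hy μ
    rw [topCurrent_of_apply_eq_dualCurrent (a := b) (fun ν => rfl), Matrix.mulVec_mulVec,
      Matrix.mul_nonsing_inv _ (det_symbolGram_ne_zero h𝔤 hΩ hA hreg hy).isUnit, Matrix.one_mulVec]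
  have h0 := hext.integral_eq_zero hΩ hA hvar fun y hy => by
    rw [← hdiv y, divergence]
    refine Finset.sum_congr rfl fun μ _ => ?_
    rw [partialD_congr_of_eqOn hΩ (fun z hz => hbJ z hz μ) hy μ, partialD,
      fderiv_apply (hv.differentiable (by simp) y)]
    rfl
  rw [← setIntegral_eq_integral_of_forall_compl_eq_zero (s := tsupport v) fun y hy => by
    simp [hv0 y hy], ← h0]
  refine setIntegral_congr_fun hvc.measurableSet fun y hy => ?_
  simp only [hext.current_eq h𝔤 hΩ hA hreg (hvΩ hy), sum_trForm_dualCurrent, hbJ y (hvΩ hy)]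

/-- A constrained extremal at which the constraint is regular solves the Beltrami equation for some
Lagrange multiplier. -/
theorem IsConstrainedExtremal.exists_isBeltrami (h𝔤 : ∀ X ∈ 𝔤, Xᴴ = -X) (hΩ : IsOpen Ω)
    (hA : IsPotential 𝔤 Ω A) (hreg : IsRegular Ω A) (hext : IsConstrainedExtremal 𝔤 Ω A) :
    ∃ f : Spacetime → ℝ, ContDiffOn ℝ ∞ f Ω ∧ IsBeltrami Ω f A := by
  set Λ : Spacetime → Spacetime →L[ℝ] ℝ :=
    fun x => ∑ μ, multiplier A x μ • ContinuousLinearMap.proj (R := ℝ) (φ := fun _ : Fin 4 => ℝ) μ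
    with hΛ
  have hΛs : ContDiffOn ℝ ∞ Λ Ω := ContDiffOn.sum fun μ _ =>
    ContDiffOn.smul (contDiffOn_multiplier h𝔤 hΩ hA hreg μ) contDiffOn_const
  have hΛv : ∀ x v, Λ x v = ∑ μ, multiplier A x μ * v μ := fun x v => by
    simp [hΛ]
  obtain ⟨g, hg, hgd⟩ := exists_primitive_of_integral_divergenceFree_eq_zero hΩ hΛs
    fun v hv hvc hvΩ hdiv => by
      simpa only [hΛv] using hext.integral_multiplier h𝔤 hΩ hA hreg hv hvc hvΩ hdiv
  -- The Euler–Lagrange expression contains `½` times `dualCurrent` of `∇f`, while the Yang–Mills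
  -- term is `dualCurrent` of `∇g`; they cancel for `f = -2 g`.
  refine ⟨fun x => -2 * g x, contDiffOn_const.mul hg, ?_⟩
  rw [isBeltrami_iff]
  intro x hx ν
  have hf : ∀ μ, partialD μ (fun x => -2 * g x) x = -2 * multiplier A x μ := fun μ => by
    rw [partialD_const_mul μ (hgd x hx).differentiableAt, partialD, (hgd x hx).fderiv, hΛv]
    simp [Pi.single_apply]
  simp only [eulerLagrange, hf, hext.current_eq h𝔤 hΩ hA hreg hx, dualCurrent, mul_smul,
    ← Finset.smul_sum]
  module

end YangMills

end

theorem theorem2 {n : ℕ} (𝔤 : LieSubalgebra ℝ (Matrix (Fin n) (Fin n) ℂ))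
    (h𝔤 : ∀ X ∈ 𝔤, Xᴴ = -X) (Ω : Set YangMills.Spacetime) (hΩ : IsOpen Ω)
    (A : YangMills.GaugeField n) (hA : YangMills.IsPotential 𝔤 Ω A) :
    (YangMills.IsConstrainedExtremal 𝔤 Ω A → YangMills.IsRegular Ω A →
      ∃ f : YangMills.Spacetime → ℝ, ContDiffOn ℝ ∞ f Ω ∧
        YangMills.IsMultiplierExtremal 𝔤 Ω f A ∧ YangMills.IsBeltrami Ω f A) ∧
    (∀ f : YangMills.Spacetime → ℝ, ContDiffOn ℝ ∞ f Ω →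
      YangMills.IsMultiplierExtremal 𝔤 Ω f A → YangMills.IsBeltrami Ω f A) := by
  refine ⟨fun hext hreg => ?_, fun f hf h =>
    (YangMills.isMultiplierExtremal_iff_isBeltrami h𝔤 hΩ hA hf).1 h⟩
  obtain ⟨f, hf, hB⟩ := hext.exists_isBeltrami h𝔤 hΩ hA hreg
  exact ⟨f, hf, (YangMills.isMultiplierExtremal_iff_isBeltrami h𝔤 hΩ hA hf).2 hB, hB⟩
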